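/- All graphs are finite, undirected and simple, and the eigenvalues of a graph are those of its adjacency matrix. For real numbers $\theta_0>\theta_1>\theta_2$ let $\mathscr G_3(\theta_0,\theta_1,\theta_2)$ be the set of connected graphs whose distinct eigenvalues are exactly $\theta_0,\theta_1,\theta_2$. The coherent rank of a graph is the dimension of its coherent closure, i.e. of the smallest algebra of complex matrices that contains $I$, $J$ (the all-ones matrix) and the adjacency matrix and is closed under transposition, matrix product and entrywise product. A quasi-symmetric design (QSD) with parameters $(v,k,\lambda;b,r,\{x,y\})$, $x\neq y$, consists of $v$ points and a family of $b$ blocks (repetitions allowed), each block being a set of $k$ points, $1\le k\le v$, such that every point lies in $r$ blocks, every two points lie together in exactly $\lambda$ blocks, every two blocks meet in $x$ or $y$ points, and both intersection sizes occur. Its $x$-block graph $\mathsf B_x(\mathcal Q)$ has the blocks as vertices, two distinct blocks being adjacent when they meet in $x$ points. Its $x$-total graph $\mathsf T_x(\mathcal Q)$ has adjacency matrix $\begin{bmatrix} O & M\\ M^\top & A(\mathsf B_x(\mathcal Q))\end{bmatrix}$, where $M$ is the incidence matrix of $\mathcal Q$ (rows indexed by points). A QSD $\mathcal Q$ is the underlying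 QSD of a graph $\Gamma$ if $\Gamma$ has exactly two distinct vertex degrees and, for some ordering $V_1,V_2$ of the two sets of vertices of equal degree, after identifying the points of $\mathcal Q$ with $V_1$ and the blocks with $V_2$, $A(\Gamma)=\begin{bmatrix}\varepsilon(J-I) & M\\ M^\top & A(\mathsf B_x(\mathcal Q))\end{bmatrix}$ with $\varepsilon\in\{0,1\}$. **Lemma 5.9.** Let $\Gamma\in\mathscr G_3(\theta_0,\theta_1,\theta_2)$ have coherent rank $9$. Suppose that the underlying QSD $\mathcal Q$ of $\Gamma$ has parameters $(v,k,\lambda;b,r,\{x,y\})$ and that the distinct eigenvalues of $\mathsf B_x(\mathcal Q)$ are $e_0>e_1>e_2$. Suppose that $\Gamma[V_1]$ is empty and $\theta_2=e_2=\frac{y-k}{x-y}$. Then $$\theta_0=\theta_2(\theta_1\theta_2-\theta_1-1),\qquad e_0=\theta_1\theta_2(\theta_2-1),\qquad e_1=\theta_1+\theta_2,$$ and $$v=\frac{\theta_2(\theta_2+\theta_1+\theta_1\theta_2-\theta_2^2\theta_1)}{\theta_1+1},\quad k=\theta_2^2,\quad \lambda=\theta_1+1,\quad b=\frac{(1+\theta_1-\theta_2\theta_1)(\theta_2+\theta_1+\theta_1\theta_2-\theta_2^2\theta_1)}{\theta_2(\theta_1+1)},$$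 $$r=\theta_1(1-\theta_2)+1,\quad x=-\theta_2,\quad y=0.\qquad(*)$$ Conversely, if for some integers $\theta_1\ge 1$ and $\theta_2\le -2$ there is a QSD $\mathcal Q$ whose parameters $(v,k,\lambda;b,r,\{x,y\})$ are given by $(*)$, then $\mathsf T_x(\mathcal Q)\in\mathscr G_3(\theta_2(\theta_1\theta_2-\theta_1-1),\theta_1,\theta_2)$ and $\mathsf T_x(\mathcal Q)$ has coherent rank $9$. -/

import Mathlib

/-- The adjacency matrix of `Γ` over `R`. -/
noncomputable def adjacencyMatrix (R : Type*) [Zero R] [One R] {V : Type*}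
    (Γ : SimpleGraph V) : Matrix V V R :=
  open Classical in Γ.adjMatrix R

/-- `Γ` has exactly three distinct eigenvalues, `e₀ > e₁ > e₂`. -/
def HasThreeEigenvalues {V : Type*} [Fintype V] [DecidableEq V]
    (Γ : SimpleGraph V) (e₀ e₁ e₂ : ℝ) : Prop :=
  e₀ > e₁ ∧ e₁ > e₂ ∧ spectrum ℝ (adjacencyMatrix ℝ Γ) = {e₀, e₁, e₂}

/-- The class `𝒢₃(θ₀, θ₁, θ₂)`: connected graphs whose distinct eigenvalues are
`θ₀ > θ₁ > θ₂`. -/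
def InG3 {V : Type*} [Fintype V] [DecidableEq V]
    (Γ : SimpleGraph V) (θ₀ θ₁ θ₂ : ℝ) : Prop :=
  Γ.Connected ∧ HasThreeEigenvalues Γ θ₀ θ₁ θ₂

/-- A matrix algebra is coherent if it contains the identity matrix (part of being a
`Subalgebra`) and the all-ones matrix, and is closed under transposition, under the matrix
product (part of being a `Subalgebra`) and under the entrywise product. -/
structure IsCoherentAlgebra {V : Type*} [Fintype V] [DecidableEq V]
    (S : Subalgebra ℂ (Matrix V V ℂ)) : Prop where
  allOnes_mem : (Matrix.of fun _ _ => 1) ∈ S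
  transpose_mem : ∀ M ∈ S, M.transpose ∈ S
  hadamard_mem : ∀ M ∈ S, ∀ N ∈ S, Matrix.hadamard M N ∈ S

/-- The coherent closure of `Γ`: the smallest coherent algebra containing its adjacency
matrix. -/
noncomputable def coherentClosure {V : Type*} [Fintype V] [DecidableEq V]
    (Γ : SimpleGraph V) : Subalgebra ℂ (Matrix V V ℂ) :=
  sInf {S | IsCoherentAlgebra S ∧ adjacencyMatrix ℂ Γ ∈ S}

theorem adjacencyMatrix_mem_coherentClosure {V : Type*} [Fintype V] [DecidableEq V]
    (Γ : SimpleGraph V) : adjacencyMatrix ℂ Γ ∈ coherentClosure Γ :=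
  Algebra.mem_sInf.2 fun _ hS => hS.2

theorem isCoherentAlgebra_coherentClosure {V : Type*} [Fintype V] [DecidableEq V]
    (Γ : SimpleGraph V) : IsCoherentAlgebra (coherentClosure Γ) where
  allOnes_mem := Algebra.mem_sInf.2 fun _ hS => hS.1.allOnes_mem
  transpose_mem M hM := Algebra.mem_sInf.2 fun S hS =>
    hS.1.transpose_mem M (Algebra.mem_sInf.1 hM S hS)
  hadamard_mem M hM N hN := Algebra.mem_sInf.2 fun S hS =>
    hS.1.hadamard_mem M (Algebra.mem_sInf.1 hM S hS) N (Algebra.mem_sInf.1 hN S hS)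

/-- The coherent rank of `Γ`: the rank of its coherent closure. A coherent algebra is spanned
by the linearly independent adjacency matrices of the relations of its coherent configuration,
so the number of relations is the dimension of the algebra. -/
noncomputable def coherentRank {V : Type*} [Fintype V] [DecidableEq V]
    (Γ : SimpleGraph V) : ℕ :=
  Module.finrank ℂ (coherentClosure Γ)

/-- The family of blocks `block : B → Finset P` (repetitions allowed) is a quasi-symmetric
2-design with parameters `(v, k, lam; b, r, {x, y})`. -/
structure IsQSD {P B : Type*} [Fintype P] [DecidableEq P] [Fintype B]
    (block : B → Finset P) (v k lam b r x y : ℕ) : Prop where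
  card_points : Fintype.card P = v
  card_blocks : Fintype.card B = b
  one_le_k : 1 ≤ k
  k_le_v : k ≤ v
  card_block : ∀ β, (block β).card = k
  replication : ∀ p, (Finset.univ.filter fun β => p ∈ block β).card = r
  balance : ∀ p q, p ≠ q →
    (Finset.univ.filter fun β => p ∈ block β ∧ q ∈ block β).card = lam
  x_ne_y : x ≠ y
  inter : ∀ β γ, β ≠ γ →
    (block β ∩ block γ).card = x ∨ (block β ∩ block γ).card = y
  x_occurs : ∃ β γ, β ≠ γ ∧ (block β ∩ block γ).card = x
  y_occurs : ∃ β γ, β ≠ γ ∧ (block β ∩ block γ).card = y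

/-- The `x`-block graph: two (indices of) distinct blocks are adjacent when the blocks
intersect in `x` points. -/
def blockGraph {P B : Type*} [DecidableEq P] (block : B → Finset P) (x : ℕ) :
    SimpleGraph B where
  Adj β γ := β ≠ γ ∧ (block β ∩ block γ).card = x
  symm := ⟨fun _ _ h => ⟨h.1.symm, by rw [Finset.inter_comm]; exact h.2⟩⟩
  loopless := ⟨fun _ h => h.1 rfl⟩

/-- The `x`-total graph: its vertices are the points and the blocks, with adjacency matrix
`[O, M; Mᵀ, X]`, where `M` is the incidence matrix and `X` is the adjacency matrix of the
`x`-block graph. -/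
def totalGraph {P B : Type*} [DecidableEq P] (block : B → Finset P) (x : ℕ) :
    SimpleGraph (P ⊕ B) where
  Adj
    | Sum.inl _, Sum.inl _ => False
    | Sum.inl p, Sum.inr β => p ∈ block β
    | Sum.inr β, Sum.inl p => p ∈ block β
    | Sum.inr β, Sum.inr γ => (blockGraph block x).Adj β γ
  symm := ⟨by
    rintro (p | β) (q | γ) h
    · exact h
    · exact h
    · exact h
    · exact SimpleGraph.Adj.symm h⟩
  loopless := ⟨by
    rintro (p | β) h
    · exact h
    · exact (blockGraph block x).irrefl h⟩

/-- `Γ` is biregular with valency partition `{V₁, V₂}`. -/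
def IsValencyBipartition {V : Type*} [Fintype V] (Γ : SimpleGraph V) (V₁ V₂ : Set V) : Prop :=
  ∃ k₁ k₂ : ℕ, k₁ ≠ k₂ ∧ V₁.Nonempty ∧ V₂.Nonempty ∧ V₁ ∪ V₂ = Set.univ ∧
    V₁ = {u | (Γ.neighborSet u).ncard = k₁} ∧ V₂ = {u | (Γ.neighborSet u).ncard = k₂}

/-- The family `block` is the underlying quasi-symmetric design of `Γ`, with parameters
`(v, k, lam; b, r, {x, y})`: the graph `Γ` is biregular with valency partition `{V₁, V₂}`, and
after identifying the points with `V₁` and the blocks with `V₂`, its adjacency matrix is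
`[ε(J - I), M; Mᵀ, X]` with `ε ∈ {0, 1}`, where `M` is the incidence matrix of the design and
`X` is the adjacency matrix of its `x`-block graph. -/
structure IsUnderlyingQSD {V P B : Type*} [Fintype V] [Fintype P] [DecidableEq P] [Fintype B]
    (Γ : SimpleGraph V) (V₁ V₂ : Set V) (block : B → Finset P)
    (v k lam b r x y : ℕ) : Prop where
  valency : IsValencyBipartition Γ V₁ V₂
  isQSD : IsQSD block v k lam b r x y
  empty_or_complete : Γ.induce V₁ = ⊥ ∨ Γ.induce V₁ = ⊤
  identification : ∃ (pt : P ≃ V₁) (bl : B ≃ V₂),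
    (∀ p β, Γ.Adj (pt p) (bl β) ↔ p ∈ block β) ∧
    (∀ β γ, Γ.Adj (bl β) (bl γ) ↔ (blockGraph block x).Adj β γ)

/-- The parameters `(v, k, lam; b, r, {x, y})` are the following functions of `θ₁` and `θ₂`. -/
structure Class1Parameters (θ₁ θ₂ : ℝ) (v k lam b r x y : ℕ) : Prop where
  v_eq : (v : ℝ) = θ₂ * (θ₂ + θ₁ + θ₁ * θ₂ - θ₂ ^ 2 * θ₁) / (θ₁ + 1)
  k_eq : (k : ℝ) = θ₂ ^ 2
  lam_eq : (lam : ℝ) = θ₁ + 1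
  b_eq : (b : ℝ) =
    (1 + θ₁ - θ₂ * θ₁) * (θ₂ + θ₁ + θ₁ * θ₂ - θ₂ ^ 2 * θ₁) / (θ₂ * (θ₁ + 1))
  r_eq : (r : ℝ) = θ₁ * (1 - θ₂) + 1
  x_eq : (x : ℝ) = -θ₂
  y_eq : (y : ℝ) = 0

/-! Write A = [O, M; Mᵀ, X] for the adjacency matrix of the total graph, X being that of the block
graph. The design axioms express MMᵀ, MᵀM, MX and X² linearly in I, J, M and X, so everything
reduces to comparing coefficients.

Forward direction: `Γ` is isomorphic to the total graph, and A has a positive eigenvector α with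
value r on points and θ on blocks, where θ² = e₀θ + kr. By Perron–Frobenius θ = θ₀ is simple, so (A
- θ₁)(A - θ₂) = cααᵀ with c > 0 (`InG3.exists_quadratic_eq`). Entries of this identity
(`IsQSD.quadratic_entries`) give e₁ = θ₁ + θ₂, x - y = -θ₂ and r - λ = -θ₁θ₂. Rank one together with
the counting identities forces y = 0. The valency of X, read from the diagonal of X², then forces λ
= θ₁ + 1, and the rest follows by counting.

Converse: put m = θ₁ and x = -θ₂. Then (A - m)(A + x) is m + 1 times the outer square of the vector
with value 1 on points and x on blocks, an eigenvector for (m(1 + x) + 1)x. This yields the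
annihilating cubic; no quadratic with real roots annihilates A, so all three roots are eigenvalues.
For the coherent rank, I and J on points, M and J, Mᵀ and J, and I, X and J on blocks span a
nine-dimensional coherent algebra containing A. Conversely the diagonal of A² separates points from
blocks, and cutting I, J and A by these two idempotents recovers all nine. -/

section

open Matrix

/-! ### Perron–Frobenius tools for symmetric matrices and graphs. -/

section Spectrum

/-- The Dirichlet form of a symmetric matrix relative to an eigenvector `α`. -/
theorem Matrix.sum_sq_sub_eq {V : Type*} [Fintype V] {A : Matrix V V ℝ} (hA : A.IsSymm)
    {α f : V → ℝ} {θ μ : ℝ}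
    (hα : A *ᵥ α = θ • α) (hf : A *ᵥ (α * f) = μ • (α * f)) :
    ∑ i, ∑ j, A i j * (α i * α j) * (f i - f j) ^ 2 =
      2 * (θ - μ) * ∑ i, (α i * f i) ^ 2 := by
  have h1 : ∀ i, ∑ j, A i j * α j = θ * α i := fun i => by
    simpa [mulVec, dotProduct] using congrFun hα i
  have h2 : ∀ i, ∑ j, A i j * (α j * f j) = μ * (α i * f i) := fun i => by
    simpa [mulVec, dotProduct] using congrFun hf i
  have e1 : ∑ i, ∑ j, A i j * (α i * α j) * f i ^ 2 = θ * ∑ i, (α i * f i) ^ 2 := by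
    rw [Finset.mul_sum]
    refine Finset.sum_congr rfl fun i _ => ?_
    have : ∀ j, A i j * (α i * α j) * f i ^ 2 = (α i * f i ^ 2) * (A i j * α j) := fun j => by ring
    simp_rw [this]
    rw [← Finset.mul_sum, h1]
    ring
  have e2 : ∑ i, ∑ j, A i j * (α i * α j) * f j ^ 2 = θ * ∑ i, (α i * f i) ^ 2 := by
    rw [Finset.sum_comm, ← e1]
    refine Finset.sum_congr rfl fun i _ => Finset.sum_congr rfl fun j _ => ?_
    rw [hA.apply i j]
    ring
  have e3 : ∑ i, ∑ j, A i j * (α i * α j) * (f i * f j) = μ * ∑ i, (α i * f i) ^ 2 := by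
    rw [Finset.mul_sum]
    refine Finset.sum_congr rfl fun i _ => ?_
    have : ∀ j, A i j * (α i * α j) * (f i * f j) = (α i * f i) * (A i j * (α j * f j)) :=
      fun j => by ring
    simp_rw [this]
    rw [← Finset.mul_sum, h2]
    ring
  have : ∀ i j, A i j * (α i * α j) * (f i - f j) ^ 2 = A i j * (α i * α j) * f i ^ 2 +
      A i j * (α i * α j) * f j ^ 2 - 2 * (A i j * (α i * α j) * (f i * f j)) :=
    fun i j => by ring
  simp_rw [this, Finset.sum_sub_distrib, Finset.sum_add_distrib, ← Finset.mul_sum]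
  rw [e1, e2, e3]
  ring

theorem mul_div_cancel_of_pos {V : Type*} {α : V → ℝ} (hpos : ∀ i, 0 < α i) (w : V → ℝ) :
    α * (w / α) = w := by
  ext i
  exact mul_div_cancel₀ _ (hpos i).ne'

variable {V : Type*} [Fintype V] [DecidableEq V]

theorem Matrix.mem_spectrum_iff_exists_mulVec {A : Matrix V V ℝ} {μ : ℝ} :
    μ ∈ spectrum ℝ A ↔ ∃ w : V → ℝ, w ≠ 0 ∧ A *ᵥ w = μ • w := by
  rw [← Matrix.spectrum_toLin', ← Module.End.hasEigenvalue_iff_mem_spectrum]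
  constructor
  · intro h
    obtain ⟨w, hw⟩ := h.exists_hasEigenvector
    exact ⟨w, hw.2, by simpa using hw.apply_eq_smul⟩
  · rintro ⟨w, hw, h⟩
    exact Module.End.hasEigenvalue_of_hasEigenvector
      (Module.End.hasEigenvector_iff.2 ⟨Module.End.mem_eigenspace_iff.2 (by simpa using h), hw⟩)

theorem Matrix.sub_smul_one_mulVec {A : Matrix V V ℝ} {μ : ℝ} {w : V → ℝ} (h : A *ᵥ w = μ • w)
    (a : ℝ) : (A - a • (1 : Matrix V V ℝ)) *ᵥ w = (μ - a) • w := by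
  rw [sub_mulVec, h, smul_mulVec, one_mulVec, sub_smul]

/-- A factorized annihilating cubic contains the spectrum among its roots. -/
theorem Matrix.eq_or_eq_or_eq_of_mem_spectrum {A : Matrix V V ℝ} {a b c μ : ℝ}
    (hA : (A - a • 1) * ((A - b • 1) * (A - c • 1)) = 0) (hμ : μ ∈ spectrum ℝ A) :
    μ = a ∨ μ = b ∨ μ = c := by
  obtain ⟨w, hw, h⟩ := mem_spectrum_iff_exists_mulVec.1 hμ
  have h0 : ((A - a • 1) * ((A - b • 1) * (A - c • 1))) *ᵥ w = 0 := by rw [hA, zero_mulVec]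
  rw [← mulVec_mulVec, ← mulVec_mulVec, sub_smul_one_mulVec h, mulVec_smul,
    sub_smul_one_mulVec h, mulVec_smul, mulVec_smul, sub_smul_one_mulVec h, smul_smul, smul_smul,
    smul_eq_zero, or_iff_left hw, mul_eq_zero, mul_eq_zero, sub_eq_zero, sub_eq_zero,
    sub_eq_zero] at h0
  tauto

/-- A symmetric real matrix whose spectrum consists of three values is annihilated by the cubic
with these roots. -/
theorem Matrix.cubic_eq_zero_of_spectrum {A : Matrix V V ℝ} (hA : A.IsSymm) {a b c : ℝ}
    (hs : spectrum ℝ A = {a, b, c}) :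
    (A - a • 1) * ((A - b • 1) * (A - c • 1)) = 0 := by
  have hsa : IsSelfAdjoint A := by
    have : Aᴴ = A := by rw [conjTranspose_eq_transpose_of_trivial]; exact hA
    exact this
  -- The functional calculus sends a polynomial that vanishes on the spectrum to zero.
  have h := cfc_polynomial
    ((Polynomial.X - Polynomial.C a) * ((Polynomial.X - Polynomial.C b) *
      (Polynomial.X - Polynomial.C c))) A hsa
  rw [cfc_congr (g := fun _ => (0 : ℝ))] at h
  · simpa [Algebra.algebraMap_eq_smul_one] using h.symm
  · intro z hz
    rw [hs] at hz
    rcases hz with rfl | rfl | rfl <;> simp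

theorem Matrix.mem_spectrum_of_mul_eq_zero {A N : Matrix V V ℝ} {μ : ℝ}
    (h : (A - μ • 1) * N = 0) (hN : N ≠ 0) : μ ∈ spectrum ℝ A := by
  rw [spectrum.mem_iff, Algebra.algebraMap_eq_smul_one]
  intro hu
  refine hN (hu.mul_right_eq_zero.1 ?_)
  rw [← neg_sub, neg_mul, h, neg_zero]

/-- The eigenvalue of a positive eigenvector of a nonnegative symmetric matrix is the largest. -/
theorem Matrix.le_of_pos_eigenvector {A : Matrix V V ℝ} (hA : A.IsSymm) (h0 : ∀ i j, 0 ≤ A i j)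
    {α : V → ℝ} {θ μ : ℝ} (hpos : ∀ i, 0 < α i) (hα : A *ᵥ α = θ • α)
    (hμ : μ ∈ spectrum ℝ A) : μ ≤ θ := by
  obtain ⟨w, hw, h⟩ := mem_spectrum_iff_exists_mulVec.1 hμ
  -- With f = w / α the nonnegative Dirichlet form equals 2(θ - μ)‖w‖².
  have key := sum_sq_sub_eq hA (f := w / α) hα (by rwa [mul_div_cancel_of_pos hpos])
  have hL : 0 ≤ ∑ i, ∑ j, A i j * (α i * α j) * ((w / α) i - (w / α) j) ^ 2 :=
    Finset.sum_nonneg fun i _ => Finset.sum_nonneg fun j _ =>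
      mul_nonneg (mul_nonneg (h0 i j) (mul_pos (hpos i) (hpos j)).le) (sq_nonneg _)
  have e : ∀ i, α i * (w / α) i = w i := fun i => congrFun (mul_div_cancel_of_pos hpos w) i
  have hS : 0 < ∑ i, (α i * (w / α) i) ^ 2 := by
    obtain ⟨i, hi⟩ := Function.ne_iff.1 hw
    refine Finset.sum_pos' (fun _ _ => sq_nonneg _) ⟨i, Finset.mem_univ _, ?_⟩
    rw [e]
    exact sq_pos_of_ne_zero hi
  rw [key] at hL
  by_contra! hlt
  nlinarith [mul_pos (sub_pos.2 hlt) hS]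

theorem adjacencyMatrix_apply (R : Type*) [Zero R] [One R] {V : Type*} (Γ : SimpleGraph V)
    (i j : V) [Decidable (Γ.Adj i j)] : adjacencyMatrix R Γ i j = if Γ.Adj i j then 1 else 0 := by
  simp [adjacencyMatrix, SimpleGraph.adjMatrix_apply]

theorem adjacencyMatrix_isSymm (R : Type*) [Zero R] [One R] {V : Type*} (Γ : SimpleGraph V) :
    (adjacencyMatrix R Γ).IsSymm := by
  classical
  ext i j
  simp [adjacencyMatrix_apply, Γ.adj_comm]

/-- In a connected graph, the eigenvalue of a positive eigenvector is simple. -/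
theorem SimpleGraph.Connected.exists_eq_smul_of_pos_eigenvector {V : Type*} [Fintype V]
    {Γ : SimpleGraph V} (hΓ : Γ.Connected) {α w : V → ℝ} {θ : ℝ} (hpos : ∀ i, 0 < α i)
    (hα : adjacencyMatrix ℝ Γ *ᵥ α = θ • α) (hw : adjacencyMatrix ℝ Γ *ᵥ w = θ • w) :
    ∃ c : ℝ, w = c • α := by
  classical
  have key := sum_sq_sub_eq (adjacencyMatrix_isSymm ℝ Γ) (f := w / α) hα
    (by rwa [mul_div_cancel_of_pos hpos])
  have hnn : ∀ i j, 0 ≤ adjacencyMatrix ℝ Γ i j * (α i * α j) * ((w / α) i - (w / α) j) ^ 2 := by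
    intro i j
    refine mul_nonneg (mul_nonneg ?_ (mul_pos (hpos i) (hpos j)).le) (sq_nonneg _)
    rw [adjacencyMatrix_apply]
    split_ifs <;> norm_num
  -- Equal eigenvalues make the Dirichlet form vanish, so w / α is constant along edges, hence along
  -- walks.
  rw [sub_self, mul_zero, zero_mul,
    Finset.sum_eq_zero_iff_of_nonneg (fun i _ => Finset.sum_nonneg fun j _ => hnn i j)] at key
  have hadj : ∀ i j, Γ.Adj i j → (w / α) i = (w / α) j := by
    intro i j hij
    have h := (Finset.sum_eq_zero_iff_of_nonneg (fun j _ => hnn i j)).1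
      (key i (Finset.mem_univ _)) j (Finset.mem_univ _)
    rw [adjacencyMatrix_apply, if_pos hij, one_mul, mul_eq_zero,
      or_iff_right (mul_pos (hpos i) (hpos j)).ne', sq_eq_zero_iff, sub_eq_zero] at h
    exact h
  have hwalk : ∀ i j, Γ.Walk i j → (w / α) i = (w / α) j := by
    intro i j p
    induction p with
    | nil => rfl
    | cons h _ ih => exact (hadj _ _ h).trans ih
  obtain ⟨i₀⟩ := hΓ.nonempty
  refine ⟨(w / α) i₀, ?_⟩
  ext i
  obtain ⟨p⟩ := hΓ.preconnected i₀ i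
  rw [Pi.smul_apply, hwalk _ _ p, smul_eq_mul, Pi.div_apply, div_mul_cancel₀ _ (hpos i).ne']

/-- In a connected graph with eigenvalues `θ₀ > θ₁ > θ₂` and a positive eigenvector `α` for `θ`,
we have `θ = θ₀`, and `(A - θ₁)(A - θ₂)` is a positive multiple of `α αᵀ`. -/
theorem InG3.exists_quadratic_eq {Γ : SimpleGraph V} {θ₀ θ₁ θ₂ : ℝ} (hΓ : InG3 Γ θ₀ θ₁ θ₂)
    {α : V → ℝ} {θ : ℝ} (hpos : ∀ i, 0 < α i) (hα : adjacencyMatrix ℝ Γ *ᵥ α = θ • α) :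
    θ = θ₀ ∧ ∃ c : ℝ, 0 < c ∧
      (adjacencyMatrix ℝ Γ - θ₁ • 1) * (adjacencyMatrix ℝ Γ - θ₂ • 1) = c • vecMulVec α α := by
  classical
  obtain ⟨hc, h01, h12, hs⟩ := hΓ
  set A := adjacencyMatrix ℝ Γ with hA
  have hsymm : A.IsSymm := adjacencyMatrix_isSymm ℝ Γ
  obtain ⟨i₀⟩ := hc.nonempty
  have hnn : ∀ i j, 0 ≤ A i j := fun i j => by
    rw [hA, adjacencyMatrix_apply]
    split_ifs <;> norm_num
  have hα0 : α ≠ 0 := fun h => (hpos i₀).ne' (congrFun h i₀)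
  have hθ : θ = θ₀ := by
    have h1 : θ ∈ spectrum ℝ A := mem_spectrum_iff_exists_mulVec.2 ⟨α, hα0, hα⟩
    have h2 : θ₀ ≤ θ := le_of_pos_eigenvector hsymm hnn hpos hα (by rw [hs]; simp)
    rw [hs] at h1
    rcases h1 with rfl | rfl | rfl
    · rfl
    · linarith
    · linarith
  refine ⟨hθ, ?_⟩
  subst hθ
  set E := (A - θ₁ • 1) * (A - θ₂ • 1) with hE
  have hcub : (A - θ • 1) * E = 0 := cubic_eq_zero_of_spectrum hsymm hs
  have hES : E.IsSymm := by
    have hx : ∀ a : ℝ, (A - a • (1 : Matrix V V ℝ))ᵀ = A - a • 1 := fun a => by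
      rw [transpose_sub, transpose_smul, transpose_one, hsymm]
    rw [IsSymm, hE, transpose_mul, hx, hx]
    simp only [sub_mul, mul_sub, smul_mul_assoc, mul_smul_comm, one_mul, mul_one]
    module
  -- The cubic says AE = θE, so each column of E lies in the simple eigenspace spanned by α.
  -- Symmetry of E then makes the factors proportional to α as well.
  have hcol : ∀ j, ∃ g : ℝ, E.col j = g • α := by
    intro j
    refine hc.exists_eq_smul_of_pos_eigenvector hpos hα ?_
    have : A * E = θ • E := by
      rw [sub_mul, smul_mul_assoc, one_mul, sub_eq_zero] at hcub
      exact hcub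
    ext i
    have := congrFun (congrFun this i) j
    simpa [mul_apply, mulVec, dotProduct] using this
  choose g hg using hcol
  have hEij : ∀ i j, E i j = g j * α i := fun i j => by
    simpa using congrFun (hg j) i
  have hgα : ∀ j, g j = g i₀ / α i₀ * α j := by
    intro j
    have := hES.apply i₀ j
    rw [hEij, hEij] at this
    rw [div_mul_eq_mul_div, eq_div_iff (hpos i₀).ne', this]
  have hEc : E = (g i₀ / α i₀) • vecMulVec α α := by
    ext i j
    rw [hEij, hgα, Matrix.smul_apply, vecMulVec_apply, smul_eq_mul]
    ring
  refine ⟨_, ?_, hEc⟩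
  -- Evaluating at α gives c‖α‖² = (θ - θ₁)(θ - θ₂) > 0, the sign of c.
  have h1 : E *ᵥ α = ((θ - θ₁) * (θ - θ₂)) • α := by
    rw [hE, ← mulVec_mulVec, sub_smul_one_mulVec hα, mulVec_smul, sub_smul_one_mulVec hα,
      smul_smul, mul_comm]
  rw [hEc] at h1
  have h2 := congrFun h1 i₀
  simp only [smul_mulVec, vecMulVec_mulVec, Pi.smul_apply, smul_eq_mul,
    op_smul_eq_smul] at h2
  have h3 : g i₀ / α i₀ * (α ⬝ᵥ α) = (θ - θ₁) * (θ - θ₂) := by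
    refine mul_right_cancel₀ (hpos i₀).ne' ?_
    rw [← h2]
    ring
  have h4 : 0 ≤ α ⬝ᵥ α := Finset.sum_nonneg fun i _ => mul_self_nonneg _
  have h5 : 0 < (θ - θ₁) * (θ - θ₂) := mul_pos (by linarith) (by linarith)
  rw [← h3] at h5
  exact pos_of_mul_pos_left h5 h4

theorem spectrum_adjacencyMatrix_eq_of_iso {W : Type*} [Fintype W] [DecidableEq W]
    {Γ : SimpleGraph V} {Δ : SimpleGraph W} (e : Γ ≃g Δ) :
    spectrum ℝ (adjacencyMatrix ℝ Δ) = spectrum ℝ (adjacencyMatrix ℝ Γ) := by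
  classical
  rw [← AlgEquiv.spectrum_eq (reindexAlgEquiv ℝ ℝ e.toEquiv) (adjacencyMatrix ℝ Γ)]
  congr 1
  ext i j
  simp only [coe_reindexAlgEquiv, reindex_apply, submatrix_apply, adjacencyMatrix_apply]
  have h : Γ.Adj (e.symm i) (e.symm j) ↔ Δ.Adj i j := e.symm.map_adj_iff
  exact if_congr h.symm rfl rfl

theorem InG3.of_iso {W : Type*} [Fintype W] [DecidableEq W] {Γ : SimpleGraph V}
    {Δ : SimpleGraph W} (e : Γ ≃g Δ) {θ₀ θ₁ θ₂ : ℝ} (h : InG3 Γ θ₀ θ₁ θ₂) : InG3 Δ θ₀ θ₁ θ₂ :=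
  ⟨e.connected_iff.1 h.1, h.2.1, h.2.2.1, by
    rw [spectrum_adjacencyMatrix_eq_of_iso e]; exact h.2.2.2⟩

end Spectrum

/-! ### Matrix identities of a quasi-symmetric design. -/

section Design

/-- The point-block incidence matrix. -/
def incidenceMatrix (R : Type*) [Zero R] [One R] {P B : Type*} [DecidableEq P]
    (block : B → Finset P) : Matrix P B R :=
  of fun p β => if p ∈ block β then 1 else 0

/-- The all-ones matrix. -/
def allOnes (m n R : Type*) [One R] : Matrix m n R :=
  of fun _ _ => 1

@[simp]
theorem allOnes_apply {m n R : Type*} [One R] (i : m) (j : n) : allOnes m n R i j = 1 := rfl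

@[simp]
theorem transpose_allOnes {m n R : Type*} [One R] : (allOnes m n R)ᵀ = allOnes n m R := rfl

theorem allOnes_mul_allOnes {l m n R : Type*} [Fintype m] [NonAssocSemiring R] :
    allOnes l m R * allOnes m n R = (Fintype.card m : R) • allOnes l n R := by
  ext i j
  simp [mul_apply]

theorem adjacencyMatrix_totalGraph (R : Type*) [Zero R] [One R] {P B : Type*} [DecidableEq P]
    (block : B → Finset P) (x : ℕ) :
    adjacencyMatrix R (totalGraph block x) = fromBlocks 0 (incidenceMatrix R block)
      (incidenceMatrix R block)ᵀ (adjacencyMatrix R (blockGraph block x)) := by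
  classical
  ext (i | i) (j | j) <;> simp only [adjacencyMatrix_apply, fromBlocks_apply₁₁,
    fromBlocks_apply₁₂, fromBlocks_apply₂₁, fromBlocks_apply₂₂, transpose_apply, incidenceMatrix,
    of_apply, totalGraph]; rfl

namespace IsQSD

variable {P B : Type*} [Fintype P] [DecidableEq P] [Fintype B] {block : B → Finset P}
  {v k lam b r x y : ℕ}

theorem nonempty_points (h : IsQSD block v k lam b r x y) : Nonempty P := by
  rw [← Fintype.card_pos_iff, h.card_points]
  exact h.one_le_k.trans h.k_le_v

theorem nonempty_blocks (h : IsQSD block v k lam b r x y) : Nonempty B :=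
  let ⟨β, _⟩ := h.x_occurs
  ⟨β⟩

/-- If every block were the whole point set, only one intersection size could occur. -/
theorem k_lt_v (h : IsQSD block v k lam b r x y) : k < v := by
  refine lt_of_le_of_ne h.k_le_v fun hkv => h.x_ne_y ?_
  have huniv : ∀ β, block β = Finset.univ := fun β => by
    rw [← Finset.card_eq_iff_eq_univ, h.card_block, h.card_points, hkv]
  obtain ⟨β, γ, _, hx⟩ := h.x_occurs
  obtain ⟨β', γ', _, hy⟩ := h.y_occurs
  rw [← hx, ← hy]
  simp only [huniv]

theorem incidenceMatrix_mul_transpose (h : IsQSD block v k lam b r x y) (R : Type*) [CommRing R] :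
    incidenceMatrix R block * (incidenceMatrix R block)ᵀ =
      ((r : R) - lam) • (1 : Matrix P P R) + (lam : R) • allOnes P P R := by
  ext p q
  have e : ((incidenceMatrix R block * (incidenceMatrix R block)ᵀ) p q : R) =
      ((Finset.univ.filter fun β => p ∈ block β ∧ q ∈ block β).card : R) := by
    simp [mul_apply, incidenceMatrix, ← ite_and]
    congr 2
    ext β
    simp [and_comm]
  rw [e]
  by_cases hpq : p = q
  · subst hpq
    simp [← h.replication p]
  · simp [h.balance p q hpq, hpq]

theorem transpose_mul_incidenceMatrix [DecidableEq B] (h : IsQSD block v k lam b r x y)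
    (R : Type*) [CommRing R] :
    (incidenceMatrix R block)ᵀ * incidenceMatrix R block =
      ((k : R) - y) • (1 : Matrix B B R) + ((x : R) - y) • adjacencyMatrix R (blockGraph block x)
        + (y : R) • allOnes B B R := by
  classical
  ext β γ
  have e : (((incidenceMatrix R block)ᵀ * incidenceMatrix R block) β γ : R) =
      ((block β ∩ block γ).card : R) := by
    simp [mul_apply, incidenceMatrix, ← ite_and]
    congr 2
    ext p
    simp [and_comm]
  rw [e]
  by_cases hβ : β = γ
  · subst hβ
    simp [h.card_block, adjacencyMatrix_apply]
  · by_cases hx : (block β ∩ block γ).card = x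
    · simp [adjacencyMatrix_apply, blockGraph, hβ, hx]
    · simp [adjacencyMatrix_apply, blockGraph, hβ, (h.inter β γ hβ).resolve_left hx,
        h.x_ne_y.symm]

theorem incidenceMatrix_mul_allOnes (h : IsQSD block v k lam b r x y) (R n : Type*) [CommRing R] :
    incidenceMatrix R block * allOnes B n R = (r : R) • allOnes P n R := by
  ext p i
  simp [mul_apply, incidenceMatrix, ← h.replication p]

theorem allOnes_mul_incidenceMatrix (h : IsQSD block v k lam b r x y) (R n : Type*) [CommRing R] :
    allOnes n P R * incidenceMatrix R block = (k : R) • allOnes n B R := by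
  ext i β
  simp [mul_apply, incidenceMatrix, ← h.card_block β]

theorem transpose_mul_allOnes (h : IsQSD block v k lam b r x y) (R n : Type*) [CommRing R] :
    (incidenceMatrix R block)ᵀ * allOnes P n R = (k : R) • allOnes B n R := by
  simpa using congrArg transpose (h.allOnes_mul_incidenceMatrix R n)

theorem allOnes_mul_transpose (h : IsQSD block v k lam b r x y) (R n : Type*) [CommRing R] :
    allOnes n B R * (incidenceMatrix R block)ᵀ = (r : R) • allOnes n P R := by
  simpa using congrArg transpose (h.incidenceMatrix_mul_allOnes R n)

theorem card_blocks_mul (h : IsQSD block v k lam b r x y) : (b : ℝ) * k = v * r := by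
  obtain ⟨p⟩ := h.nonempty_points
  have e : (allOnes P P ℝ * incidenceMatrix ℝ block) * allOnes B P ℝ =
      allOnes P P ℝ * (incidenceMatrix ℝ block * allOnes B P ℝ) := Matrix.mul_assoc ..
  rw [h.allOnes_mul_incidenceMatrix, h.incidenceMatrix_mul_allOnes, Matrix.mul_smul,
    Matrix.smul_mul, allOnes_mul_allOnes, allOnes_mul_allOnes, h.card_points, h.card_blocks] at e
  have := congrFun (congrFun e p) p
  simp only [Matrix.smul_apply, allOnes_apply, smul_eq_mul, mul_one] at this
  linarith

theorem replication_mul (h : IsQSD block v k lam b r x y) :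
    (k : ℝ) * r = r - lam + lam * v := by
  obtain ⟨p⟩ := h.nonempty_points
  have e : (incidenceMatrix ℝ block * (incidenceMatrix ℝ block)ᵀ) * allOnes P P ℝ =
      incidenceMatrix ℝ block * ((incidenceMatrix ℝ block)ᵀ * allOnes P P ℝ) :=
    Matrix.mul_assoc ..
  rw [h.incidenceMatrix_mul_transpose, h.transpose_mul_allOnes, Matrix.mul_smul,
    h.incidenceMatrix_mul_allOnes, Matrix.add_mul, Matrix.smul_mul, Matrix.smul_mul, Matrix.one_mul,
    allOnes_mul_allOnes, h.card_points] at e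
  have := congrFun (congrFun e p) p
  simp only [Matrix.smul_apply, Matrix.add_apply, allOnes_apply, smul_eq_mul, mul_one] at this
  linarith

/-- The incidence matrix times the adjacency matrix of the block graph. -/
theorem incidenceMatrix_mul_blockGraph [DecidableEq B] (h : IsQSD block v k lam b r x y)
    (R : Type*) [CommRing R] :
    ((x : R) - y) • (incidenceMatrix R block * adjacencyMatrix R (blockGraph block x)) =
      ((r : R) - lam - k + y) • incidenceMatrix R block +
        ((lam : R) * k - y * r) • allOnes P B R := by
  have e : (incidenceMatrix R block * (incidenceMatrix R block)ᵀ) * incidenceMatrix R block =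
      incidenceMatrix R block * ((incidenceMatrix R block)ᵀ * incidenceMatrix R block) :=
    Matrix.mul_assoc ..
  rw [h.incidenceMatrix_mul_transpose, h.transpose_mul_incidenceMatrix, Matrix.mul_add,
    Matrix.mul_add, Matrix.mul_smul, Matrix.mul_smul, Matrix.mul_smul, Matrix.mul_one,
    h.incidenceMatrix_mul_allOnes, Matrix.add_mul,
    Matrix.smul_mul, Matrix.smul_mul, Matrix.one_mul, h.allOnes_mul_incidenceMatrix] at e
  linear_combination (norm := module) -e

theorem blockGraph_mul_allOnes [DecidableEq B] (h : IsQSD block v k lam b r x y)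
    (R n : Type*) [CommRing R] :
    ((x : R) - y) • (adjacencyMatrix R (blockGraph block x) * allOnes B n R) =
      ((k : R) * r - (k - y) - y * b) • allOnes B n R := by
  have e : ((incidenceMatrix R block)ᵀ * incidenceMatrix R block) * allOnes B n R =
      (incidenceMatrix R block)ᵀ * (incidenceMatrix R block * allOnes B n R) :=
    Matrix.mul_assoc ..
  rw [h.incidenceMatrix_mul_allOnes, h.transpose_mul_incidenceMatrix, Matrix.mul_smul,
    h.transpose_mul_allOnes, Matrix.add_mul, Matrix.add_mul, Matrix.smul_mul, Matrix.smul_mul,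
    Matrix.smul_mul,
    Matrix.one_mul, allOnes_mul_allOnes, h.card_blocks] at e
  linear_combination (norm := module) e

/-- The square of the adjacency matrix of the block graph. -/
theorem blockGraph_mul_blockGraph [DecidableEq B] (h : IsQSD block v k lam b r x y)
    (R : Type*) [CommRing R] :
    ((x : R) - y) ^ 2 • (adjacencyMatrix R (blockGraph block x) *
        adjacencyMatrix R (blockGraph block x)) =
      (((x : R) - y) * (r - lam - 2 * k + 2 * y)) • adjacencyMatrix R (blockGraph block x) +
      (((k : R) - y) * (r - lam - k + y)) • (1 : Matrix B B R) +
      ((lam : R) * k ^ 2 - 2 * y * k * r + y ^ 2 * b + y * (r - lam)) • allOnes B B R := by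
  have hX : (adjacencyMatrix R (blockGraph block x))ᵀ = adjacencyMatrix R (blockGraph block x) :=
    (adjacencyMatrix_isSymm R _).eq
  have e1 : ((incidenceMatrix R block)ᵀ * incidenceMatrix R block) *
      adjacencyMatrix R (blockGraph block x) = (incidenceMatrix R block)ᵀ *
        (incidenceMatrix R block * adjacencyMatrix R (blockGraph block x)) := Matrix.mul_assoc ..
  -- Multiplying the formula for MX by Mᵀ and replacing MᵀM by its expression in X produces X²; the
  -- remaining JX is a multiple of J.
  have e2 := congrArg ((incidenceMatrix R block)ᵀ * ·) (h.incidenceMatrix_mul_blockGraph R)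
  have e3 : ((x : R) - y) • (allOnes B B R * adjacencyMatrix R (blockGraph block x)) =
      ((k : R) * r - (k - y) - y * b) • allOnes B B R := by
    simpa [hX] using congrArg transpose (h.blockGraph_mul_allOnes R B)
  simp only [Matrix.mul_add, Matrix.mul_smul, h.transpose_mul_allOnes] at e2
  rw [← e1, h.transpose_mul_incidenceMatrix] at e2
  simp only [Matrix.add_mul, Matrix.smul_mul, Matrix.one_mul] at e2
  linear_combination (norm := module) e2 - (y : R) • e3

end IsQSD
end Design

/-! ### From the eigenvalues of the total graph to the parameters. -/

section Forward

namespace IsQSD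

variable {P B : Type*} [Fintype P] [DecidableEq P] [Fintype B]
  {block : B → Finset P} {v k lam b r x y : ℕ}

theorem cast_sub_ne_zero (h : IsQSD block v k lam b r x y) : (x : ℝ) - y ≠ 0 :=
  sub_ne_zero.2 (Nat.cast_injective.ne h.x_ne_y)

theorem incidenceMatrix_mul_blockGraph_real [DecidableEq B] (h : IsQSD block v k lam b r x y) :
    incidenceMatrix ℝ block * adjacencyMatrix ℝ (blockGraph block x) =
      (((r : ℝ) - lam - k + y) / (x - y)) • incidenceMatrix ℝ block +
        (((lam : ℝ) * k - y * r) / (x - y)) • allOnes P B ℝ := by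
  have e := congrArg (((x : ℝ) - y)⁻¹ • ·) (h.incidenceMatrix_mul_blockGraph ℝ)
  simp only [smul_add, inv_smul_smul₀ h.cast_sub_ne_zero, smul_smul] at e
  simpa only [div_eq_inv_mul] using e

theorem blockGraph_mul_allOnes_real [DecidableEq B] (h : IsQSD block v k lam b r x y) (n : Type*) :
    adjacencyMatrix ℝ (blockGraph block x) * allOnes B n ℝ =
      (((k : ℝ) * r - (k - y) - y * b) / (x - y)) • allOnes B n ℝ := by
  have e := congrArg (((x : ℝ) - y)⁻¹ • ·) (h.blockGraph_mul_allOnes ℝ n)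
  simp only [inv_smul_smul₀ h.cast_sub_ne_zero, smul_smul] at e
  simpa only [div_eq_inv_mul] using e

theorem blockGraph_mul_blockGraph_real [DecidableEq B] (h : IsQSD block v k lam b r x y) :
    adjacencyMatrix ℝ (blockGraph block x) * adjacencyMatrix ℝ (blockGraph block x) =
      (((r : ℝ) - lam - k + y) / (x - y) + ((y : ℝ) - k) / (x - y)) •
        adjacencyMatrix ℝ (blockGraph block x) -
      (((r : ℝ) - lam - k + y) / (x - y) * (((y : ℝ) - k) / (x - y))) • (1 : Matrix B B ℝ) +
      (((lam : ℝ) * k ^ 2 - 2 * y * k * r + y ^ 2 * b + y * (r - lam)) / (x - y) ^ 2) •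
        allOnes B B ℝ := by
  have h0 := h.cast_sub_ne_zero
  have e := congrArg ((((x : ℝ) - y) ^ 2)⁻¹ • ·) (h.blockGraph_mul_blockGraph ℝ)
  simp only [smul_add, inv_smul_smul₀ (pow_ne_zero 2 h0), smul_smul] at e
  rw [e, sub_eq_add_neg (_ • adjacencyMatrix ℝ (blockGraph block x)), ← neg_smul]
  simp only [div_eq_inv_mul]
  congr 3
  · field_simp
    ring
  · field_simp
    ring

/-- The last two factors multiply to a multiple of J, which the first one kills because X is
regular. -/
theorem blockGraph_cubic [DecidableEq B] (h : IsQSD block v k lam b r x y) :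
    (adjacencyMatrix ℝ (blockGraph block x) -
        (((k : ℝ) * r - (k - y) - y * b) / (x - y)) • 1) *
      ((adjacencyMatrix ℝ (blockGraph block x) - (((r : ℝ) - lam - k + y) / (x - y)) • 1) *
        (adjacencyMatrix ℝ (blockGraph block x) - (((y : ℝ) - k) / (x - y)) • 1)) = 0 := by
  have e : (adjacencyMatrix ℝ (blockGraph block x) - (((r : ℝ) - lam - k + y) / (x - y)) • 1) *
      (adjacencyMatrix ℝ (blockGraph block x) - (((y : ℝ) - k) / (x - y)) • 1) =
      (((lam : ℝ) * k ^ 2 - 2 * y * k * r + y ^ 2 * b + y * (r - lam)) / (x - y) ^ 2) •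
        allOnes B B ℝ := by
    simp only [sub_mul, mul_sub, Matrix.smul_mul, Matrix.mul_smul, one_mul, mul_one]
    rw [h.blockGraph_mul_blockGraph_real]
    module
  rw [e, Matrix.mul_smul, sub_mul, h.blockGraph_mul_allOnes_real, Matrix.smul_mul, one_mul,
    sub_self, smul_zero]

theorem incidenceMatrix_mulVec_const (h : IsQSD block v k lam b r x y) (a : ℝ) :
    (incidenceMatrix ℝ block *ᵥ fun _ => a) = fun _ => r * a := by
  ext p
  have := congrFun (congrFun (h.incidenceMatrix_mul_allOnes ℝ Unit) p) ()
  simp only [mul_apply, allOnes_apply, mul_one, Matrix.smul_apply, smul_eq_mul] at this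
  simp only [mulVec, dotProduct]
  rw [← Finset.sum_mul, this]

theorem transpose_mulVec_const (h : IsQSD block v k lam b r x y) (a : ℝ) :
    ((incidenceMatrix ℝ block)ᵀ *ᵥ fun _ => a) = fun _ => k * a := by
  ext p
  have := congrFun (congrFun (h.transpose_mul_allOnes ℝ Unit) p) ()
  simp only [mul_apply, allOnes_apply, mul_one, Matrix.smul_apply, smul_eq_mul] at this
  simp only [mulVec, dotProduct]
  rw [← Finset.sum_mul, this]

theorem blockGraph_mulVec_const [DecidableEq B] (h : IsQSD block v k lam b r x y) (a : ℝ) :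
    (adjacencyMatrix ℝ (blockGraph block x) *ᵥ fun _ => a) =
      fun _ => ((k : ℝ) * r - (k - y) - y * b) / (x - y) * a := by
  ext p
  have := congrFun (congrFun (h.blockGraph_mul_allOnes_real Unit) p) ()
  simp only [mul_apply, allOnes_apply, mul_one, Matrix.smul_apply, smul_eq_mul] at this
  simp only [mulVec, dotProduct]
  rw [← Finset.sum_mul, this]

theorem totalGraph_mulVec_elim [DecidableEq B] (h : IsQSD block v k lam b r x y) (a c : ℝ) :
    (adjacencyMatrix ℝ (totalGraph block x) *ᵥ Sum.elim (fun _ => a) fun _ => c) =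
      Sum.elim (fun _ => r * c)
        fun _ => k * a + ((k : ℝ) * r - (k - y) - y * b) / (x - y) * c := by
  rw [adjacencyMatrix_totalGraph, fromBlocks_mulVec]
  ext (i | i)
  · simp only [Sum.elim_inl, Sum.elim_comp_inl, Sum.elim_comp_inr, zero_mulVec,
      h.incidenceMatrix_mulVec_const, zero_add]
  · simp only [Sum.elim_inr, Sum.elim_comp_inl, Sum.elim_comp_inr, Pi.add_apply,
      h.transpose_mulVec_const, h.blockGraph_mulVec_const]

/-- The valency of X is both its row sum and the diagonal entry of X². -/
theorem card_block_neighbors [DecidableEq B] (h : IsQSD block v k lam b r x y) :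
    ((k : ℝ) * r - (k - y) - y * b) / (x - y) =
      (((lam : ℝ) * k ^ 2 - 2 * y * k * r + y ^ 2 * b + y * (r - lam)) / (x - y) ^ 2) -
        ((r : ℝ) - lam - k + y) / (x - y) * (((y : ℝ) - k) / (x - y)) := by
  classical
  obtain ⟨β⟩ := h.nonempty_blocks
  have e1 := congrFun (congrFun h.blockGraph_mul_blockGraph_real β) β
  have e2 := congrFun (h.blockGraph_mulVec_const 1) β
  have e3 : (adjacencyMatrix ℝ (blockGraph block x) * adjacencyMatrix ℝ (blockGraph block x)) β β =
      (adjacencyMatrix ℝ (blockGraph block x) *ᵥ fun _ => 1) β := by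
    rw [mul_apply]
    refine Finset.sum_congr rfl fun γ _ => ?_
    by_cases hadj : (blockGraph block x).Adj β γ
    · simp [adjacencyMatrix_apply, hadj, hadj.symm]
    · simp [adjacencyMatrix_apply, hadj]
  rw [e2, mul_one] at e3
  rw [e3] at e1
  simp only [Matrix.add_apply, Matrix.sub_apply, Matrix.smul_apply, smul_eq_mul, allOnes_apply,
    one_apply_eq, adjacencyMatrix_apply, SimpleGraph.irrefl, if_false] at e1
  linarith

/-- The two largest eigenvalues of the block graph, if the smallest is `(y - k) / (x - y)`. -/
theorem blockGraph_eigenvalues [DecidableEq B] (h : IsQSD block v k lam b r x y) {e₀ e₁ e₂ : ℝ}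
    (hX : HasThreeEigenvalues (blockGraph block x) e₀ e₁ e₂)
    (he₂ : e₂ = ((y : ℝ) - k) / (x - y)) :
    e₀ = ((k : ℝ) * r - (k - y) - y * b) / (x - y) ∧ e₁ = ((r : ℝ) - lam - k + y) / (x - y) := by
  classical
  obtain ⟨h01, h12, hs⟩ := hX
  -- The all-ones vector is a positive eigenvector, so e₀ is at most the valency; this settles which
  -- root of the cubic is which.
  have hle : e₀ ≤ ((k : ℝ) * r - (k - y) - y * b) / (x - y) := by
    refine le_of_pos_eigenvector (adjacencyMatrix_isSymm ℝ (blockGraph block x)) (fun i j => ?_)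
      (α := fun _ => 1) (fun _ => one_pos) ?_ (by rw [hs]; simp)
    · rw [adjacencyMatrix_apply]
      split_ifs <;> norm_num
    · rw [h.blockGraph_mulVec_const]
      rfl
  have m0 : e₀ ∈ spectrum ℝ (adjacencyMatrix ℝ (blockGraph block x)) := by rw [hs]; simp
  have m1 : e₁ ∈ spectrum ℝ (adjacencyMatrix ℝ (blockGraph block x)) := by rw [hs]; simp
  have c0 := eq_or_eq_or_eq_of_mem_spectrum h.blockGraph_cubic m0
  have c1 := eq_or_eq_or_eq_of_mem_spectrum h.blockGraph_cubic m1
  rw [← he₂] at c0 c1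
  rcases c0 with c0 | c0 | c0 <;> rcases c1 with c1 | c1 | c1 <;>
    first | exact ⟨c0, c1⟩ | (exfalso; linarith)

theorem v_pos (h : IsQSD block v k lam b r x y) : (1 : ℝ) ≤ (v : ℝ) - 1 := by
  have h1 : (k : ℝ) + 1 ≤ v := by exact_mod_cast h.k_lt_v
  have h2 : (1 : ℝ) ≤ k := by exact_mod_cast h.one_le_k
  linarith

theorem r_pos (h : IsQSD block v k lam b r x y) : (0 : ℝ) < r := by
  have hb : (0 : ℝ) < b := by
    have := h.nonempty_blocks
    rw [← h.card_blocks]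
    exact_mod_cast Fintype.card_pos
  have hk : (0 : ℝ) < k := by exact_mod_cast h.one_le_k
  have := h.card_blocks_mul
  have hv := h.v_pos
  have : (0 : ℝ) < v * r := by rw [← this]; positivity
  exact pos_of_mul_pos_right this (by linarith)

theorem lam_le_r (h : IsQSD block v k lam b r x y) : (lam : ℝ) ≤ r := by
  have h1 : (k : ℝ) + 1 ≤ v := by exact_mod_cast h.k_lt_v
  have := h.replication_mul
  have hv := h.v_pos
  have hr := h.r_pos
  by_contra! hlt
  nlinarith

theorem nontrivial_points (h : IsQSD block v k lam b r x y) : Nontrivial P := by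
  rw [← Fintype.one_lt_card_iff_nontrivial, h.card_points]
  exact h.one_le_k.trans_lt h.k_lt_v

theorem exists_mem_block (h : IsQSD block v k lam b r x y) (β : B) : ∃ p, p ∈ block β :=
  Finset.card_pos.1 (by rw [h.card_block]; exact h.one_le_k)

theorem exists_notMem_block (h : IsQSD block v k lam b r x y) (β : B) : ∃ p, p ∉ block β := by
  by_contra! hall
  have := Finset.card_eq_iff_eq_univ (block β) |>.2 (Finset.eq_univ_iff_forall.2 hall)
  rw [h.card_block, h.card_points] at this
  exact h.k_lt_v.ne this

/-- One entry is read off for each kind of pair: distinct or equal points, incident or non-incident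
point and block, adjacent or non-adjacent distinct blocks. The right-hand side does not distinguish
incidence or adjacency, so the coefficients of M and of X must vanish; these are the third and last
conclusions. -/
theorem quadratic_entries [DecidableEq B] (h : IsQSD block v k lam b r x y) {θ₁ θ₂ a a' c : ℝ}
    (hE : (adjacencyMatrix ℝ (totalGraph block x) - θ₁ • 1) *
      (adjacencyMatrix ℝ (totalGraph block x) - θ₂ • 1) =
        c • vecMulVec (Sum.elim (fun _ => a) fun _ => a') (Sum.elim (fun _ => a) fun _ => a')) :
    lam = c * (a * a) ∧ r + θ₁ * θ₂ = c * (a * a) ∧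
      ((r : ℝ) - lam - k + y) / (x - y) = θ₁ + θ₂ ∧
      ((lam : ℝ) * k - y * r) / (x - y) = c * (a * a') ∧
      y + ((lam : ℝ) * k ^ 2 - 2 * y * k * r + y ^ 2 * b + y * (r - lam)) / (x - y) ^ 2 =
        c * (a' * a') ∧
      (x : ℝ) - y + ((y : ℝ) - k) / (x - y) = 0  := by
  classical
  have e1 : adjacencyMatrix ℝ (totalGraph block x) * adjacencyMatrix ℝ (totalGraph block x) -
      (θ₁ + θ₂) • adjacencyMatrix ℝ (totalGraph block x) + (θ₁ * θ₂) • 1 =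
      c • vecMulVec (Sum.elim (fun _ => a) fun _ => a') (Sum.elim (fun _ => a) fun _ => a') := by
    rw [← hE]
    simp only [sub_mul, mul_sub, Matrix.smul_mul, Matrix.mul_smul, one_mul, mul_one]
    module
  rw [adjacencyMatrix_totalGraph, fromBlocks_multiply, h.incidenceMatrix_mul_transpose,
    h.transpose_mul_incidenceMatrix, h.incidenceMatrix_mul_blockGraph_real,
    h.blockGraph_mul_blockGraph_real] at e1
  have e11 : ∀ p q, _ := fun p q => congrFun (congrFun e1 (Sum.inl p)) (Sum.inl q)
  have e12 : ∀ p q, _ := fun p q => congrFun (congrFun e1 (Sum.inl p)) (Sum.inr q)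
  have e22 : ∀ p q, _ := fun p q => congrFun (congrFun e1 (Sum.inr p)) (Sum.inr q)
  simp only [Matrix.add_apply, Matrix.sub_apply, Matrix.smul_apply, fromBlocks_apply₁₁,
    fromBlocks_apply₁₂, fromBlocks_apply₂₂, smul_eq_mul, allOnes_apply, vecMulVec_apply,
    Sum.elim_inl, Sum.elim_inr, one_apply, Sum.inl.injEq, Sum.inr.injEq, Matrix.zero_mul,
    Matrix.zero_apply, Matrix.mul_zero, reduceCtorEq, if_false, incidenceMatrix, of_apply,
    adjacencyMatrix_apply] at e11 e12 e22
  have := h.nontrivial_points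
  obtain ⟨p, q, hpq⟩ := exists_pair_ne P
  obtain ⟨β, γ, hβγ, hx⟩ := h.x_occurs
  obtain ⟨β', γ', hβγ', hy⟩ := h.y_occurs
  obtain ⟨i, hi⟩ := h.exists_mem_block β
  obtain ⟨j, hj⟩ := h.exists_notMem_block β
  have a1 := e11 p q
  have a2 := e11 p p
  have a3 := e12 i β
  have a4 := e12 j β
  have a5 := e22 β γ
  have a6 := e22 β' γ'
  have hadj : (blockGraph block x).Adj β γ := ⟨hβγ, hx⟩
  have hnadj : ¬ (blockGraph block x).Adj β' γ' := fun hh => h.x_ne_y (hh.2.symm.trans hy)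
  simp only [if_neg hpq, if_pos hi, if_neg hj, if_neg hβγ, if_neg hβγ', if_pos hadj, if_neg hnadj,
    if_true] at a1 a2 a3 a4 a5 a6
  refine ⟨?_, ?_, ?_, ?_, ?_, ?_⟩ <;> linarith

theorem class1Parameters_of_totalGraph [DecidableEq B] (h : IsQSD block v k lam b r x y)
    {θ₀ θ₁ θ₂ e₀ e₁ e₂ : ℝ}
    (hG : InG3 (totalGraph block x) θ₀ θ₁ θ₂)
    (hX : HasThreeEigenvalues (blockGraph block x) e₀ e₁ e₂)
    (hθ : θ₂ = e₂) (he₂ : e₂ = ((y : ℝ) - k) / (x - y)) :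
    θ₀ = θ₂ * (θ₁ * θ₂ - θ₁ - 1) ∧ e₀ = θ₁ * θ₂ * (θ₂ - 1) ∧ e₁ = θ₁ + θ₂ ∧
      Class1Parameters θ₁ θ₂ v k lam b r x y := by
  subst hθ
  obtain ⟨he₀, he₁⟩ := h.blockGraph_eigenvalues hX he₂
  have h12 : θ₂ < e₁ := hX.2.1
  have hk : (0 : ℝ) < k := by exact_mod_cast h.one_le_k
  have hr := h.r_pos
  have hlr := h.lam_le_r
  have hv := h.v_pos
  have hbk := h.card_blocks_mul
  have hrep := h.replication_mul
  have hy0 : (0 : ℝ) ≤ y := Nat.cast_nonneg y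
  have hlam0 : (0 : ℝ) ≤ lam := Nat.cast_nonneg lam
  have ht0 := h.cast_sub_ne_zero
  -- This is the condition for the vector (r, θ) to be an eigenvector for θ; the positive root makes
  -- it positive.
  obtain ⟨θ, hθpos, hθeq⟩ : ∃ θ : ℝ, 0 < θ ∧ k * r + e₀ * θ = θ * θ := by
    have hkr : (0 : ℝ) < 4 * (k * r) := by positivity
    have hsq := Real.mul_self_sqrt (show 0 ≤ e₀ ^ 2 + 4 * (k * r) by positivity)
    refine ⟨(e₀ + √(e₀ ^ 2 + 4 * (k * r))) / 2, ?_, by linarith⟩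
    have : -e₀ < √(e₀ ^ 2 + 4 * (k * r)) := by
      refine lt_of_le_of_lt (neg_le_abs e₀) ?_
      rw [← Real.sqrt_sq_eq_abs]
      exact Real.sqrt_lt_sqrt (sq_nonneg _) (by linarith)
    linarith
  obtain ⟨hθ0, c, hc, hE⟩ := hG.exists_quadratic_eq
    (α := Sum.elim (fun _ => (r : ℝ)) fun _ => θ) (θ := θ)
    (by rintro (i | i); exacts [hr, hθpos]) (by
      rw [h.totalGraph_mulVec_elim, ← he₀, hθeq]
      ext (i | i)
      · simp [mul_comm]
      · simp)
  obtain ⟨a1, a2, a3, a4, a5, a6⟩ := h.quadratic_entries hE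
  have a7 := h.card_block_neighbors
  rw [← he₁, ← he₂, ← he₀] at a7
  rw [← he₁] at a3
  rw [← he₂] at a6
  clear hG hX hE
  obtain ⟨t, ht⟩ : ∃ t : ℝ, (x : ℝ) - y = t := ⟨_, rfl⟩
  rw [ht] at ht0 he₀ he₁ he₂ a4 a5 a6
  have hθt : θ₂ = -t := by linarith
  have hky : (k : ℝ) = y + t ^ 2 := by
    rw [hθt, eq_div_iff ht0] at he₂
    linarith
  have hrl : (r : ℝ) = lam + θ₁ * t := by
    rw [hθt] at a2
    linarith
  have hθ1 : 0 < θ₁ := by linarith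
  -- Since r - λ = θ₁t with θ₁ > 0, a negative t would contradict λ ≤ r.
  have htpos : 0 < t := by
    by_contra! hle
    have : t < 0 := lt_of_le_of_ne hle ht0
    nlinarith [mul_pos_of_neg_of_neg this (neg_neg_of_pos hθ1)]
  have hlampos : (0 : ℝ) < lam := by rw [a1]; positivity
  have hγ : 0 < (lam : ℝ) * k - y * r := by
    have : 0 < ((lam : ℝ) * k - y * r) / t := by rw [a4]; positivity
    exact (div_pos_iff_of_pos_right htpos).1 this
  rw [div_eq_iff ht0] at a4
  have a5' : (y : ℝ) * t ^ 2 + (lam * k ^ 2 - 2 * y * k * r + y ^ 2 * b + y * (r - lam)) =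
      c * (θ * θ) * t ^ 2 := by
    rw [← a5]
    field_simp
  -- Rank one gives (cr²)(cθ²) = (crθ)², and y is a factor of the resulting relation. If y > 0,
  -- cancelling it and using bk = vr and kr = r - λ + λv leaves λkt² + (r - λ)(λk - yr) = 0, a
  -- positive plus a nonnegative term.
  have hy : (y : ℝ) = 0 := by
    by_contra hne
    have hypos : (0 : ℝ) < y := lt_of_le_of_ne hy0 (Ne.symm hne)
    have h1 : (lam : ℝ) * ((y : ℝ) * t ^ 2 +
        (lam * k ^ 2 - 2 * y * k * r + y ^ 2 * b + y * (r - lam))) =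
        (lam * k - y * r) ^ 2 := by
      rw [a5', a4]
      nth_rw 1 [a1]
      ring
    have h2 : (y : ℝ) * (lam * (t ^ 2 + y * b + (r - lam)) - y * r ^ 2) = 0 := by
      linear_combination h1
    have h3 := (mul_eq_zero.1 h2).resolve_left hne
    have h4 : (lam : ℝ) * k * t ^ 2 + (r - lam) * (lam * k - y * r) = 0 := by
      linear_combination k * h3 - y * lam * hbk + y * r * hrep
    have h5 : 0 < (lam : ℝ) * k * t ^ 2 := by positivity
    have h6 : 0 ≤ ((r : ℝ) - lam) * (lam * k - y * r) :=
      mul_nonneg (by linarith) hγ.le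
    linarith
  have hk2 : (k : ℝ) = t ^ 2 := by rw [hky, hy, zero_add]
  have hd : e₀ = t * (r - 1) := by
    rw [he₀, hy, hk2]
    field_simp
    ring
  -- The two expressions for the valency of X are compared.
  have hlt : (lam : ℝ) * (t - 1) = (θ₁ + 1) * (t - 1) := by
    rw [ht, hy, a3, hk2, hd, hrl, hθt] at a7
    have : t * (lam + θ₁ * t - 1) = lam * t ^ 2 + (θ₁ - t) * t := by
      rw [a7]
      field_simp
      ring
    refine mul_left_cancel₀ ht0 ?_
    linear_combination -this
  -- If t = 1 then k = 1, so no block contains two points, against λ > 0.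
  have ht1 : t - 1 ≠ 0 := by
    intro h1
    rw [hk2, show t = 1 by linarith] at hrep
    have : (lam : ℝ) * (v - 1) = 0 := by linarith
    rcases mul_eq_zero.1 this with h0 | h0 <;> linarith
  have hlam : (lam : ℝ) = θ₁ + 1 := mul_right_cancel₀ ht1 hlt
  have hθ' : θ = r * t := by
    have : (c * r) * θ = (c * r) * (r * t) := by
      rw [hk2, hy] at a4
      have h1 : c * (r * θ) * t = lam * t ^ 2 := by linarith
      refine mul_right_cancel₀ ht0 ?_
      rw [a1] at h1
      linear_combination h1
    exact mul_left_cancel₀ (by positivity) this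
  have hteq : t = -θ₂ := by linarith
  have hθ1' : θ₁ + 1 ≠ 0 := by linarith
  have hθ2 : θ₂ ≠ 0 := by linarith
  have hr' : (r : ℝ) = θ₁ * (1 - θ₂) + 1 := by rw [hrl, hlam, hteq]; ring
  have hk' : (k : ℝ) = θ₂ ^ 2 := by rw [hk2, hteq]; ring
  have hv' : (v : ℝ) = θ₂ * (θ₂ + θ₁ + θ₁ * θ₂ - θ₂ ^ 2 * θ₁) / (θ₁ + 1) := by
    rw [eq_div_iff hθ1']
    rw [hlam, hr', hk'] at hrep
    linear_combination -hrep
  refine ⟨by rw [← hθ0, hθ', hr', hteq]; ring, by rw [hd, hr', hteq]; ring, a3, hv', hk', hlam, ?_,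
    hr', by linarith, hy⟩
  rw [hk', hv', hr'] at hbk
  field_simp at hbk ⊢
  linear_combination hbk

end IsQSD
end Forward

/-! ### The graph is the total graph of its underlying design. -/

section Identification

theorem IsUnderlyingQSD.nonempty_iso_totalGraph {V P B : Type*} [Fintype V] [Fintype P]
    [DecidableEq P] [Fintype B] {Γ : SimpleGraph V} {V₁ V₂ : Set V} {block : B → Finset P}
    {v k lam b r x y : ℕ} (h : IsUnderlyingQSD Γ V₁ V₂ block v k lam b r x y)
    (hbot : Γ.induce V₁ = ⊥) : Nonempty (Γ ≃g totalGraph block x) := by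
  obtain ⟨k₁, k₂, hne, -, -, huniv, h₁, h₂⟩ := h.valency
  obtain ⟨pt, bl, hinc, hadj⟩ := h.identification
  have hdisj : ∀ u, u ∈ V₁ → u ∈ V₂ → False := by
    intro u hu₁ hu₂
    rw [h₁] at hu₁
    rw [h₂] at hu₂
    exact hne (hu₁.symm.trans hu₂)
  have hindep : ∀ p q, ¬ Γ.Adj (pt p) (pt q) := by
    intro p q hpq
    have : (Γ.induce V₁).Adj (pt p) (pt q) := hpq
    rw [hbot] at this
    exact this
  have hbij : Function.Bijective (Sum.elim (fun p => (pt p : V)) fun β => (bl β : V)) := by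
    constructor
    · rintro (p | β) (q | γ) hpq
      · exact congrArg Sum.inl (pt.injective (Subtype.ext hpq))
      · exact (hdisj _ (pt p).2 (by rw [show (pt p : V) = bl γ from hpq]; exact (bl γ).2)).elim
      · exact (hdisj _ (pt q).2 (by rw [show (pt q : V) = bl β from hpq.symm]; exact (bl β).2)).elim
      · exact congrArg Sum.inr (bl.injective (Subtype.ext hpq))
    · intro u
      have hu : u ∈ V₁ ∪ V₂ := huniv ▸ Set.mem_univ u
      rcases hu with hu | hu
      · exact ⟨Sum.inl (pt.symm ⟨u, hu⟩), by simp⟩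
      · exact ⟨Sum.inr (bl.symm ⟨u, hu⟩), by simp⟩
  refine ⟨SimpleGraph.Iso.symm ⟨Equiv.ofBijective _ hbij, ?_⟩⟩
  rintro (p | β) (q | γ)
  · exact iff_of_false (hindep p q) id
  · exact hinc p γ
  · exact (Γ.adj_comm _ _).trans (hinc q β)
  · exact hadj β γ

end Identification

/-! ### The spectrum of the total graph for the given parameters. -/

section Converse

theorem Matrix.fromBlocks_sub {n o l m α : Type*} [AddGroup α] (A A' : Matrix n l α)
    (B B' : Matrix n m α) (C C' : Matrix o l α) (D D' : Matrix o m α) :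
    fromBlocks A B C D - fromBlocks A' B' C' D' =
      fromBlocks (A - A') (B - B') (C - C') (D - D') := by
  ext (i | i) (j | j) <;> rfl

namespace IsQSD

variable {P B : Type*} [Fintype P] [DecidableEq P] [Fintype B] {block : B → Finset P}
  {v b m x : ℕ}

/-- Any two points share a block, and every block contains a point. -/
theorem connected_totalGraph {k lam r y : ℕ} (h : IsQSD block v k lam b r x y) (hlam : 0 < lam) :
    (totalGraph block x).Connected := by
  have hpb : ∀ p β, p ∈ block β → (totalGraph block x).Reachable (Sum.inl p) (Sum.inr β) :=
    fun p β hp => SimpleGraph.Adj.reachable hp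
  have hpp : ∀ p q, (totalGraph block x).Reachable (Sum.inl p) (Sum.inl q) := by
    intro p q
    by_cases hpq : p = q
    · rw [hpq]
    · have hpos := h.balance p q hpq ▸ hlam
      obtain ⟨β, hβ⟩ := Finset.card_pos.1 hpos
      rw [Finset.mem_filter] at hβ
      exact (hpb p β hβ.2.1).trans (hpb q β hβ.2.2).symm
  obtain ⟨p₀⟩ := h.nonempty_points
  have hall : ∀ u, (totalGraph block x).Reachable (Sum.inl p₀) u := by
    rintro (q | β)
    · exact hpp p₀ q
    · obtain ⟨q, hq⟩ := h.exists_mem_block β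
      exact (hpp p₀ q).trans (hpb q β hq)
  exact (SimpleGraph.connected_iff _).2
    ⟨fun u w => (hall u).symm.trans (hall w), ⟨Sum.inl p₀⟩⟩

section Relations

variable (K : Type*) [Field K]

/-- This and the following relations specialise the design identities to k = x², λ = m + 1, r = m(1
+ x) + 1, y = 0. The field is general because the spectrum needs ℝ and the coherent closure ℂ. -/
theorem class1_incidenceMatrix_mul_transpose
    (h : IsQSD block v (x ^ 2) (m + 1) b (m * (1 + x) + 1) x 0) :
    incidenceMatrix K block * (incidenceMatrix K block)ᵀ =
      ((m : K) * x) • (1 : Matrix P P K) + ((m : K) + 1) • allOnes P P K := by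
  rw [h.incidenceMatrix_mul_transpose]
  push_cast
  congr 2
  ring

theorem class1_transpose_mul_incidenceMatrix [DecidableEq B]
    (h : IsQSD block v (x ^ 2) (m + 1) b (m * (1 + x) + 1) x 0) :
    (incidenceMatrix K block)ᵀ * incidenceMatrix K block =
      ((x : K) ^ 2) • (1 : Matrix B B K) + (x : K) • adjacencyMatrix K (blockGraph block x) := by
  rw [h.transpose_mul_incidenceMatrix]
  push_cast
  module

theorem class1_incidenceMatrix_mul_blockGraph [DecidableEq B]
    (h : IsQSD block v (x ^ 2) (m + 1) b (m * (1 + x) + 1) x 0) (hx : (x : K) ≠ 0) :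
    incidenceMatrix K block * adjacencyMatrix K (blockGraph block x) =
      ((m : K) - x) • incidenceMatrix K block + (((m : K) + 1) * x) • allOnes P B K := by
  have e := h.incidenceMatrix_mul_blockGraph K
  push_cast at e
  rw [sub_zero] at e
  refine (smul_right_injective _ hx) ?_
  linear_combination (norm := module) e

theorem class1_blockGraph_mul_transpose [DecidableEq B]
    (h : IsQSD block v (x ^ 2) (m + 1) b (m * (1 + x) + 1) x 0) (hx : (x : K) ≠ 0) :
    adjacencyMatrix K (blockGraph block x) * (incidenceMatrix K block)ᵀ =
      ((m : K) - x) • (incidenceMatrix K block)ᵀ + (((m : K) + 1) * x) • allOnes B P K := by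
  simpa [(adjacencyMatrix_isSymm K (blockGraph block x)).eq] using
    congrArg transpose (h.class1_incidenceMatrix_mul_blockGraph K hx)

theorem class1_blockGraph_mul_allOnes [DecidableEq B] (n : Type*)
    (h : IsQSD block v (x ^ 2) (m + 1) b (m * (1 + x) + 1) x 0) (hx : (x : K) ≠ 0) :
    adjacencyMatrix K (blockGraph block x) * allOnes B n K =
      ((x : K) * (m * (1 + x))) • allOnes B n K := by
  have e := h.blockGraph_mul_allOnes K n
  push_cast at e
  rw [sub_zero] at e
  refine (smul_right_injective _ hx) ?_
  linear_combination (norm := module) e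

theorem class1_allOnes_mul_blockGraph [DecidableEq B] (n : Type*)
    (h : IsQSD block v (x ^ 2) (m + 1) b (m * (1 + x) + 1) x 0) (hx : (x : K) ≠ 0) :
    allOnes n B K * adjacencyMatrix K (blockGraph block x) =
      ((x : K) * (m * (1 + x))) • allOnes n B K := by
  have hX : (adjacencyMatrix K (blockGraph block x))ᵀ = adjacencyMatrix K (blockGraph block x) :=
    (adjacencyMatrix_isSymm K _).eq
  simpa [hX] using congrArg transpose (h.class1_blockGraph_mul_allOnes K n hx)

theorem class1_blockGraph_mul_blockGraph [DecidableEq B]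
    (h : IsQSD block v (x ^ 2) (m + 1) b (m * (1 + x) + 1) x 0) (hx : (x : K) ≠ 0) :
    adjacencyMatrix K (blockGraph block x) * adjacencyMatrix K (blockGraph block x) =
      ((m : K) - 2 * x) • adjacencyMatrix K (blockGraph block x) +
        (((m : K) - x) * x) • (1 : Matrix B B K) +
        (((m : K) + 1) * x ^ 2) • allOnes B B K := by
  have e := h.blockGraph_mul_blockGraph K
  push_cast at e
  rw [sub_zero] at e
  refine (smul_right_injective _ (pow_ne_zero 2 hx)) ?_
  linear_combination (norm := module) e

end Relations

/-- The right-hand side is m + 1 times the outer square of the Perron vector, 1 on points and x on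
blocks. -/
theorem class1_totalGraph_quadratic [DecidableEq B]
    (h : IsQSD block v (x ^ 2) (m + 1) b (m * (1 + x) + 1) x 0) (hx : (x : ℝ) ≠ 0) :
    (adjacencyMatrix ℝ (totalGraph block x) - (m : ℝ) • 1) *
      (adjacencyMatrix ℝ (totalGraph block x) - (-(x : ℝ)) • 1) =
        ((m : ℝ) + 1) • fromBlocks (allOnes P P ℝ) ((x : ℝ) • allOnes P B ℝ)
          ((x : ℝ) • allOnes B P ℝ) ((x : ℝ) ^ 2 • allOnes B B ℝ) := by
  rw [adjacencyMatrix_totalGraph, ← fromBlocks_one, fromBlocks_smul, fromBlocks_smul,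
    fromBlocks_sub, fromBlocks_sub, fromBlocks_multiply, fromBlocks_smul]
  simp only [Matrix.sub_mul, Matrix.mul_sub, Matrix.neg_mul, Matrix.mul_neg, Matrix.smul_mul,
    Matrix.mul_smul, Matrix.mul_one, Matrix.one_mul, smul_zero, sub_zero, zero_sub,
    h.class1_incidenceMatrix_mul_transpose ℝ, h.class1_transpose_mul_incidenceMatrix ℝ,
    h.class1_incidenceMatrix_mul_blockGraph ℝ hx, h.class1_blockGraph_mul_transpose ℝ hx,
    h.class1_blockGraph_mul_blockGraph ℝ hx]
  congr 1 <;> module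

theorem class1_inG3_totalGraph [DecidableEq B]
    (h : IsQSD block v (x ^ 2) (m + 1) b (m * (1 + x) + 1) x 0) (hm : 1 ≤ m) (hx : 2 ≤ x) :
    InG3 (totalGraph block x) (((m : ℝ) * (1 + x) + 1) * x) m (-x) := by
  have hxR : (2 : ℝ) ≤ x := by exact_mod_cast hx
  have hmR : (1 : ℝ) ≤ m := by exact_mod_cast hm
  have hx0 : (x : ℝ) ≠ 0 := by linarith
  have hQ := h.class1_totalGraph_quadratic hx0
  have hA : adjacencyMatrix ℝ (totalGraph block x) *
      fromBlocks (allOnes P P ℝ) ((x : ℝ) • allOnes P B ℝ) ((x : ℝ) • allOnes B P ℝ)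
        ((x : ℝ) ^ 2 • allOnes B B ℝ) =
      (((m : ℝ) * (1 + x) + 1) * x) • fromBlocks (allOnes P P ℝ) ((x : ℝ) • allOnes P B ℝ)
        ((x : ℝ) • allOnes B P ℝ) ((x : ℝ) ^ 2 • allOnes B B ℝ) := by
    rw [adjacencyMatrix_totalGraph, fromBlocks_multiply, fromBlocks_smul]
    simp only [Matrix.zero_mul, Matrix.mul_smul, h.incidenceMatrix_mul_allOnes,
      h.transpose_mul_allOnes, h.class1_blockGraph_mul_allOnes ℝ _ hx0]
    push_cast
    congr 1 <;> module
  have hcub : (adjacencyMatrix ℝ (totalGraph block x) -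
      (((m : ℝ) * (1 + x) + 1) * x) • 1) *
      ((adjacencyMatrix ℝ (totalGraph block x) - (m : ℝ) • 1) *
        (adjacencyMatrix ℝ (totalGraph block x) - (-(x : ℝ)) • 1)) = 0 := by
    rw [hQ, Matrix.mul_smul, Matrix.sub_mul, hA, Matrix.smul_mul, Matrix.one_mul, sub_self,
      smul_zero]
  have := h.nontrivial_points
  obtain ⟨p, q, hpq⟩ := exists_pair_ne P
  -- a quadratic polynomial in the adjacency matrix does not vanish
  have hne : ∀ a c : ℝ, (adjacencyMatrix ℝ (totalGraph block x) - a • 1) *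
      (adjacencyMatrix ℝ (totalGraph block x) - c • 1) ≠ 0 := by
    intro a c h0
    -- At two distinct points only MMᵀ contributes, with entry λ = m + 1 > 0.
    have e := congrFun (congrFun h0 (Sum.inl p)) (Sum.inl q)
    rw [adjacencyMatrix_totalGraph, ← fromBlocks_one, fromBlocks_smul, fromBlocks_smul,
      fromBlocks_sub, fromBlocks_sub, fromBlocks_multiply, fromBlocks_apply₁₁] at e
    simp only [zero_sub, smul_zero, sub_zero, h.class1_incidenceMatrix_mul_transpose ℝ,
      Matrix.neg_mul, Matrix.mul_neg, Matrix.smul_mul, Matrix.mul_smul, Matrix.one_mul,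
      Matrix.add_apply, Matrix.neg_apply, Matrix.smul_apply, one_apply_ne hpq, allOnes_apply,
      Matrix.zero_apply, smul_eq_mul] at e
    linarith
  have hcomm : ∀ a c : ℝ, Commute (adjacencyMatrix ℝ (totalGraph block x) - a • 1)
      (adjacencyMatrix ℝ (totalGraph block x) - c • 1) := fun a c =>
    ((Commute.refl _).sub_left ((Commute.one_left _).smul_left a)).sub_right
      ((Commute.one_right _).smul_right c)
  refine ⟨h.connected_totalGraph (Nat.succ_pos m), by nlinarith, by linarith, ?_⟩
  refine Set.Subset.antisymm (fun μ hμ => eq_or_eq_or_eq_of_mem_spectrum hcub hμ) ?_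
  -- For each root, the product of the other two factors is nonzero and is annihilated by A - μ; the
  -- factors commute.
  rintro μ (rfl | rfl | rfl)
  · exact mem_spectrum_of_mul_eq_zero hcub (hne _ _)
  · refine mem_spectrum_of_mul_eq_zero (N := _ * _) ?_ (hne (((m : ℝ) * (1 + x) + 1) * x) (-x))
    rw [← mul_assoc, (hcomm _ _).eq, mul_assoc, hcub]
  · refine mem_spectrum_of_mul_eq_zero (N := _ * _) ?_ (hne (((m : ℝ) * (1 + x) + 1) * x) m)
    rw [← mul_assoc, (hcomm _ _).eq, mul_assoc, (hcomm _ _).eq, hcub]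

end IsQSD
end Converse

/-! ### The nine-dimensional coherent closure. -/

section CoherentRank

namespace IsQSD

variable {P B : Type*} [DecidableEq P] [DecidableEq B]
  {block : B → Finset P} {v b m x : ℕ}

/-- The linear parametrization of the matrices that are constant on the relations equality,
inequality (of points), incidence, non-incidence (and their converses), equality, adjacency,
non-adjacency (of blocks). -/
noncomputable def relationMatrix (block : B → Finset P) (x : ℕ) :
    (Fin 9 → ℂ) →ₗ[ℂ] Matrix (P ⊕ B) (P ⊕ B) ℂ where
  toFun a := fromBlocks
    (a 0 • 1 + a 1 • allOnes P P ℂ)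
    (a 2 • incidenceMatrix ℂ block + a 3 • allOnes P B ℂ)
    (a 4 • (incidenceMatrix ℂ block)ᵀ + a 5 • allOnes B P ℂ)
    (a 6 • 1 + a 7 • adjacencyMatrix ℂ (blockGraph block x) + a 8 • allOnes B B ℂ)
  map_add' a c := by
    rw [fromBlocks_add]
    simp only [Pi.add_apply]
    congr 1 <;> module
  map_smul' a c := by
    rw [fromBlocks_smul]
    simp only [Pi.smul_apply, smul_eq_mul, RingHom.id_apply]
    congr 1 <;> module

theorem relationMatrix_apply (a : Fin 9 → ℂ) : relationMatrix block x a = fromBlocks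
    (a 0 • 1 + a 1 • allOnes P P ℂ)
    (a 2 • incidenceMatrix ℂ block + a 3 • allOnes P B ℂ)
    (a 4 • (incidenceMatrix ℂ block)ᵀ + a 5 • allOnes B P ℂ)
    (a 6 • 1 + a 7 • adjacencyMatrix ℂ (blockGraph block x) + a 8 • allOnes B B ℂ) := rfl

/-- Every relation is nonempty. In each of the four corners, the entries where only J contributes
fix its coefficient first. -/
theorem relationMatrix_injective [Fintype P] [Fintype B] {k lam r y : ℕ}
    (h : IsQSD block v k lam b r x y) :
    Function.Injective (relationMatrix block x) := by
  classical
  rw [injective_iff_map_eq_zero]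
  intro a ha
  rw [relationMatrix_apply] at ha
  have e11 : ∀ p q, _ := fun p q => congrFun (congrFun ha (Sum.inl p)) (Sum.inl q)
  have e12 : ∀ p q, _ := fun p q => congrFun (congrFun ha (Sum.inl p)) (Sum.inr q)
  have e21 : ∀ p q, _ := fun p q => congrFun (congrFun ha (Sum.inr p)) (Sum.inl q)
  have e22 : ∀ p q, _ := fun p q => congrFun (congrFun ha (Sum.inr p)) (Sum.inr q)
  simp only [fromBlocks_apply₁₁, fromBlocks_apply₁₂, fromBlocks_apply₂₁, fromBlocks_apply₂₂,
    Matrix.add_apply, Matrix.smul_apply, smul_eq_mul, allOnes_apply, one_apply,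
    incidenceMatrix, transpose_apply, of_apply, Matrix.zero_apply, adjacencyMatrix_apply]
    at e11 e12 e21 e22
  have := h.nontrivial_points
  obtain ⟨p, q, hpq⟩ := exists_pair_ne P
  obtain ⟨β, γ, hβγ, hx⟩ := h.x_occurs
  obtain ⟨β', γ', hβγ', hy⟩ := h.y_occurs
  obtain ⟨i, hi⟩ := h.exists_mem_block β
  obtain ⟨j, hj⟩ := h.exists_notMem_block β
  have hadj : (blockGraph block x).Adj β γ := ⟨hβγ, hx⟩
  have hnadj : ¬ (blockGraph block x).Adj β' γ' := fun hh => h.x_ne_y (hh.2.symm.trans hy)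
  have a1 : a 1 = 0 := by simpa [hpq] using e11 p q
  have a0 : a 0 = 0 := by simpa [a1] using e11 p p
  have a3 : a 3 = 0 := by simpa [hj] using e12 j β
  have a2 : a 2 = 0 := by simpa [hi, a3] using e12 i β
  have a5 : a 5 = 0 := by simpa [hj] using e21 β j
  have a4 : a 4 = 0 := by simpa [hi, a5] using e21 β i
  have a8 : a 8 = 0 := by simpa [hβγ', hnadj] using e22 β' γ'
  have a7 : a 7 = 0 := by simpa [hβγ, hadj, a8] using e22 β γ
  have a6 : a 6 = 0 := by simpa [a8] using e22 β β
  ext l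
  fin_cases l <;> assumption

/-- The vector collects the structure constants of the matrix product in the nine spanning matrices.
-/
theorem relationMatrix_mul [Fintype P] [Fintype B]
    (h : IsQSD block v (x ^ 2) (m + 1) b (m * (1 + x) + 1) x 0)
    (hx : (x : ℂ) ≠ 0) (a c : Fin 9 → ℂ) :
    relationMatrix block x a * relationMatrix block x c = relationMatrix block x
      ![a 0 * c 0 + a 2 * c 4 * (m * x),
        a 0 * c 1 + a 1 * c 0 + a 1 * c 1 * v + a 2 * c 4 * (m + 1) +
          (a 2 * c 5 + a 3 * c 4) * (m * (1 + x) + 1) + a 3 * c 5 * b,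
        a 0 * c 2 + a 2 * c 6 + a 2 * c 7 * (m - x),
        a 0 * c 3 + a 1 * c 2 * x ^ 2 + a 1 * c 3 * v + a 2 * c 7 * ((m + 1) * x) +
          a 2 * c 8 * (m * (1 + x) + 1) + a 3 * c 6 + a 3 * c 7 * (x * (m * (1 + x))) +
          a 3 * c 8 * b,
        a 4 * c 0 + a 6 * c 4 + a 7 * c 4 * (m - x),
        a 4 * c 1 * x ^ 2 + a 5 * c 0 + a 5 * c 1 * v + a 7 * c 4 * ((m + 1) * x) +
          a 8 * c 4 * (m * (1 + x) + 1) + a 6 * c 5 + a 7 * c 5 * (x * (m * (1 + x))) +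
          a 8 * c 5 * b,
        a 4 * c 2 * x ^ 2 + a 6 * c 6 + a 7 * c 7 * ((m - x) * x),
        a 4 * c 2 * x + a 6 * c 7 + a 7 * c 6 + a 7 * c 7 * (m - 2 * x),
        (a 4 * c 3 + a 5 * c 2) * x ^ 2 + a 5 * c 3 * v + a 6 * c 8 + a 8 * c 6 +
          a 7 * c 7 * ((m + 1) * x ^ 2) + (a 7 * c 8 + a 8 * c 7) * (x * (m * (1 + x))) +
          a 8 * c 8 * b] := by
  simp only [relationMatrix_apply, fromBlocks_multiply]
  simp only [Matrix.mul_add, Matrix.add_mul, Matrix.smul_mul, Matrix.mul_smul, Matrix.mul_one,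
    Matrix.one_mul, h.class1_incidenceMatrix_mul_transpose ℂ, h.incidenceMatrix_mul_allOnes,
    h.class1_transpose_mul_incidenceMatrix ℂ, h.class1_incidenceMatrix_mul_blockGraph ℂ hx,
    h.class1_blockGraph_mul_transpose ℂ hx, h.class1_blockGraph_mul_allOnes ℂ _ hx,
    h.class1_allOnes_mul_blockGraph ℂ _ hx, h.class1_blockGraph_mul_blockGraph ℂ hx,
    h.allOnes_mul_incidenceMatrix, h.transpose_mul_allOnes, h.allOnes_mul_transpose,
    allOnes_mul_allOnes, h.card_points, h.card_blocks]
  push_cast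
  congr 1 <;> simp <;> module

/-- In each corner J is the entrywise unit, and the other spanning matrices are 0/1 with disjoint
supports. -/
theorem relationMatrix_hadamard (a c : Fin 9 → ℂ) :
    hadamard (relationMatrix block x a) (relationMatrix block x c) = relationMatrix block x
      ![a 0 * c 0 + a 0 * c 1 + a 1 * c 0, a 1 * c 1,
        a 2 * c 2 + a 2 * c 3 + a 3 * c 2, a 3 * c 3,
        a 4 * c 4 + a 4 * c 5 + a 5 * c 4, a 5 * c 5,
        a 6 * c 6 + a 6 * c 8 + a 8 * c 6, a 7 * c 7 + a 7 * c 8 + a 8 * c 7, a 8 * c 8] := by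
  classical
  ext (p | β) (q | γ)
  · by_cases hpq : p = q <;> simp [relationMatrix_apply, hadamard_apply, hpq] <;> ring
  · by_cases hp : p ∈ block γ <;>
      simp [relationMatrix_apply, hadamard_apply, incidenceMatrix, hp] <;> ring
  · by_cases hp : q ∈ block β <;>
      simp [relationMatrix_apply, hadamard_apply, incidenceMatrix, hp] <;> ring
  · by_cases hβγ : β = γ
    · simp [relationMatrix_apply, hadamard_apply, adjacencyMatrix_apply, hβγ]
      ring
    · by_cases hadj : (blockGraph block x).Adj β γ <;>
        simp [relationMatrix_apply, hadamard_apply, adjacencyMatrix_apply, hβγ, hadj] <;> ring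

theorem relationMatrix_transpose (a : Fin 9 → ℂ) :
    (relationMatrix block x a)ᵀ =
      relationMatrix block x ![a 0, a 1, a 4, a 5, a 2, a 3, a 6, a 7, a 8] := by
  simp [relationMatrix_apply, fromBlocks_transpose,
    (adjacencyMatrix_isSymm ℂ (blockGraph block x)).eq]

theorem relationMatrix_one :
    relationMatrix block x ![1, 0, 0, 0, 0, 0, 1, 0, 0] = 1 := by
  simp [relationMatrix_apply]

theorem relationMatrix_allOnes :
    relationMatrix block x ![0, 1, 0, 1, 0, 1, 0, 0, 1] = of fun _ _ => 1 := by
  ext (i | i) (j | j) <;> simp [relationMatrix_apply]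

theorem relationMatrix_adjacencyMatrix :
    relationMatrix block x ![0, 0, 1, 0, 1, 0, 0, 1, 0] =
      adjacencyMatrix ℂ (totalGraph block x) := by
  simp [relationMatrix_apply, adjacencyMatrix_totalGraph]

theorem class1_coherentClosure_le [Fintype P] [Fintype B]
    (h : IsQSD block v (x ^ 2) (m + 1) b (m * (1 + x) + 1) x 0) (hx : (x : ℂ) ≠ 0) :
    (coherentClosure (totalGraph block x)).toSubmodule ≤
      LinearMap.range (relationMatrix block x) := by
  let S : Subalgebra ℂ (Matrix (P ⊕ B) (P ⊕ B) ℂ) :=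
    (LinearMap.range (relationMatrix block x)).toSubalgebra ⟨_, relationMatrix_one⟩ (by
      rintro _ _ ⟨a, rfl⟩ ⟨c, rfl⟩
      exact ⟨_, (h.relationMatrix_mul hx a c).symm⟩)
  have hS : IsCoherentAlgebra S :=
    { allOnes_mem := ⟨_, relationMatrix_allOnes⟩
      transpose_mem := by
        rintro _ ⟨a, rfl⟩
        exact ⟨_, (relationMatrix_transpose a).symm⟩
      hadamard_mem := by
        rintro _ ⟨a, rfl⟩ _ ⟨c, rfl⟩
        exact ⟨_, (relationMatrix_hadamard a c).symm⟩ }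
  exact fun N hN => Algebra.mem_sInf.1 hN S ⟨hS, ⟨_, relationMatrix_adjacencyMatrix⟩⟩

/-- A coherent algebra that contains the adjacency matrix of the total graph separates points and
blocks by their valency. -/
theorem class1_blockIdentity_mem [Fintype P] [Fintype B]
    (h : IsQSD block v (x ^ 2) (m + 1) b (m * (1 + x) + 1) x 0) (hx : 2 ≤ x)
    {S : Subalgebra ℂ (Matrix (P ⊕ B) (P ⊕ B) ℂ)} (hS : IsCoherentAlgebra S)
    (hA : adjacencyMatrix ℂ (totalGraph block x) ∈ S) :
    fromBlocks 0 0 0 (1 : Matrix B B ℂ) ∈ S := by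
  have hx0 : (x : ℂ) ≠ 0 := by exact_mod_cast (by lia : x ≠ 0)
  have hd : ((m : ℂ) + 1) * (x ^ 2 - 1) ≠ 0 := by
    have h1 : (m + 1) * (x ^ 2 - 1) ≠ 0 := by
      have : 1 < x ^ 2 := Nat.one_lt_pow two_ne_zero hx
      exact Nat.mul_ne_zero (by lia) (by lia)
    have h2 : 1 ≤ x ^ 2 := Nat.one_le_pow _ _ (by lia)
    have h3 : (((m + 1) * (x ^ 2 - 1) : ℕ) : ℂ) ≠ 0 := Nat.cast_ne_zero.2 h1
    push_cast [h2] at h3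
    exact h3
  -- The entrywise product of A² with I is the diagonal of valencies. Points have valency r = m(1 +
  -- x) + 1 and blocks x² + xm(1 + x); the difference is (m + 1)(x² - 1), nonzero as x ≥ 2.
  have hmem := S.smul_mem (S.sub_mem (hS.hadamard_mem _ (S.mul_mem hA hA) _ S.one_mem)
    (S.smul_mem S.one_mem ((m : ℂ) * (1 + x) + 1))) (((m : ℂ) + 1) * (x ^ 2 - 1))⁻¹
  convert hmem using 1
  rw [eq_inv_smul_iff₀ hd, ← relationMatrix_adjacencyMatrix, h.relationMatrix_mul hx0,
    ← relationMatrix_one (block := block) (x := x), relationMatrix_hadamard,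
    ← map_smul, ← map_sub, relationMatrix_apply, fromBlocks_smul]
  congr 1
  · simp
    module
  · simp
  · simp
  · simp
    module

theorem class1_le_coherentClosure [Fintype P] [Fintype B]
    (h : IsQSD block v (x ^ 2) (m + 1) b (m * (1 + x) + 1) x 0) (hx : 2 ≤ x) :
    LinearMap.range (relationMatrix block x) ≤
      (coherentClosure (totalGraph block x)).toSubmodule := by
  rintro _ ⟨a, rfl⟩
  change _ ∈ coherentClosure (totalGraph block x)
  have hC := isCoherentAlgebra_coherentClosure (totalGraph block x)
  have hA := adjacencyMatrix_mem_coherentClosure (totalGraph block x)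
  have hB := h.class1_blockIdentity_mem hx hC hA
  set S := coherentClosure (totalGraph block x)
  have hP : fromBlocks (1 : Matrix P P ℂ) 0 0 0 ∈ S := by
    have := S.sub_mem S.one_mem hB
    rw [← fromBlocks_one, fromBlocks_sub] at this
    simpa using this
  have hJ : fromBlocks (allOnes P P ℂ) (allOnes P B ℂ) (allOnes B P ℂ) (allOnes B B ℂ) ∈ S := by
    convert hC.allOnes_mem using 1
    ext (i | i) (j | j) <;> rfl
  rw [adjacencyMatrix_totalGraph] at hA
  -- Multiplying by the point and block idempotents on both sides cuts I, J and A into corners,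
  -- which are then recombined.
  have hmem := S.add_mem
    (S.add_mem
      (S.mul_mem (S.mul_mem hP (S.add_mem (S.smul_mem S.one_mem (a 0)) (S.smul_mem hJ (a 1)))) hP)
      (S.mul_mem (S.mul_mem hP (S.add_mem (S.smul_mem hA (a 2)) (S.smul_mem hJ (a 3)))) hB))
    (S.add_mem
      (S.mul_mem (S.mul_mem hB (S.add_mem (S.smul_mem hA (a 4)) (S.smul_mem hJ (a 5)))) hP)
      (S.mul_mem (S.mul_mem hB (S.add_mem (S.add_mem (S.smul_mem S.one_mem (a 6))
        (S.smul_mem hA (a 7))) (S.smul_mem hJ (a 8)))) hB))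
  convert hmem using 1
  rw [relationMatrix_apply, ← fromBlocks_one]
  simp [fromBlocks_multiply, fromBlocks_smul, fromBlocks_add, -fromBlocks_one]

theorem class1_coherentRank_totalGraph [Fintype P] [Fintype B]
    (h : IsQSD block v (x ^ 2) (m + 1) b (m * (1 + x) + 1) x 0) (hx : 2 ≤ x) :
    coherentRank (totalGraph block x) = 9 := by
  have hx0 : (x : ℂ) ≠ 0 := by exact_mod_cast (by lia : x ≠ 0)
  have e := le_antisymm (h.class1_coherentClosure_le hx0) (h.class1_le_coherentClosure hx)
  calc coherentRank (totalGraph block x)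
      = Module.finrank ℂ (coherentClosure (totalGraph block x)).toSubmodule := rfl
    _ = 9 := by
      rw [e, LinearMap.finrank_range_of_inj h.relationMatrix_injective, Module.finrank_fin_fun]

end IsQSD

/-- Using x for -θ₂ expresses these parameters in natural numbers without subtraction. -/
theorem Class1Parameters.exists_nat {θ₁ θ₂ : ℤ} {v k lam b r x y : ℕ} (hθ₁ : 1 ≤ θ₁)
    (h : Class1Parameters θ₁ θ₂ v k lam b r x y) :
    ∃ m : ℕ, θ₁ = m ∧ θ₂ = -x ∧ k = x ^ 2 ∧ lam = m + 1 ∧ r = m * (1 + x) + 1 ∧ y = 0 := by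
  obtain ⟨m, rfl⟩ := Int.eq_ofNat_of_zero_le (zero_le_one.trans hθ₁)
  have hx : (θ₂ : ℝ) = -(x : ℝ) := by linarith [h.x_eq]
  have hk := h.k_eq
  have hl := h.lam_eq
  have hr := h.r_eq
  have hy := h.y_eq
  rw [hx] at hk hr
  rw [neg_sq] at hk
  rw [sub_neg_eq_add] at hr
  exact ⟨m, rfl, by exact_mod_cast hx, by exact_mod_cast hk, by exact_mod_cast hl,
    by exact_mod_cast hr, by exact_mod_cast hy⟩

end CoherentRank

end

theorem lemma5p9 {P B : Type*} [Fintype P] [DecidableEq P] [Fintype B] [DecidableEq B]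
    (block : B → Finset P) (v k lam b r x y : ℕ) :
    (∀ {V : Type*} [Fintype V] [DecidableEq V] (Γ : SimpleGraph V) (V₁ V₂ : Set V)
        (θ₀ θ₁ θ₂ e₀ e₁ e₂ : ℝ),
        InG3 Γ θ₀ θ₁ θ₂ →
        coherentRank Γ = 9 →
        IsUnderlyingQSD Γ V₁ V₂ block v k lam b r x y →
        HasThreeEigenvalues (blockGraph block x) e₀ e₁ e₂ →
        Γ.induce V₁ = ⊥ →
        θ₂ = e₂ →
        e₂ = ((y : ℝ) - k) / ((x : ℝ) - y) →
        θ₀ = θ₂ * (θ₁ * θ₂ - θ₁ - 1) ∧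
        e₀ = θ₁ * θ₂ * (θ₂ - 1) ∧
        e₁ = θ₁ + θ₂ ∧
        Class1Parameters θ₁ θ₂ v k lam b r x y) ∧
    (∀ θ₁ θ₂ : ℤ, 1 ≤ θ₁ → θ₂ ≤ -2 →
        IsQSD block v k lam b r x y →
        Class1Parameters θ₁ θ₂ v k lam b r x y →
        InG3 (totalGraph block x) (θ₂ * (θ₁ * θ₂ - θ₁ - 1)) θ₁ θ₂ ∧
        coherentRank (totalGraph block x) = 9) := by
  refine ⟨?_, ?_⟩
  · intro V _ _ Γ V₁ V₂ θ₀ θ₁ θ₂ e₀ e₁ e₂ hG _ hU hX hbot hθ he₂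
    obtain ⟨e⟩ := hU.nonempty_iso_totalGraph hbot
    exact hU.isQSD.class1Parameters_of_totalGraph (hG.of_iso e) hX hθ he₂
  · intro θ₁ θ₂ hθ₁ hθ₂ h hpar
    obtain ⟨m, rfl, rfl, rfl, rfl, rfl, rfl⟩ := hpar.exists_nat hθ₁
    have hx : 2 ≤ x := by lia
    refine ⟨?_, h.class1_coherentRank_totalGraph hx⟩
    convert h.class1_inG3_totalGraph (by lia) hx using 1
    · push_cast
      ring
    · norm_cast
    · norm_cast
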